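/- **Definitions.** Let $z_1,\dots,z_k$ ($k\ge 1$) be complex indeterminates. A $[p,n,k]$ *complex orthogonal design* (COD) is a $p\times n$ matrix $G$ whose entries lie in $\{0,\pm z_i,\pm z_i^*: 1\le i\le k\}$ and which satisfies $G^HG=(|z_1|^2+\dots+|z_k|^2)I_n$ identically. The *equivalence operations* on a $[p,n,k]$ COD are: permuting rows, negating a row, permuting columns, negating a column, permuting the names of the indeterminates, negating all instances of one indeterminate, and conjugating all instances of one indeterminate. Two CODs are *equivalent* if one can be changed into the other by a finite sequence of equivalence operations. A $[p,2m,k]$ COD $G$ is a *balanced complex orthogonal design* (BCOD) if (i) every row has exactly $m$ zero and $m$ nonzero entries; (ii) the nonzero entries of each row are either all conjugated or all non-conjugated; (iii) for every $j\in\{1,\dots,k\}$, $G$ can be transformed, by equivalence operations other than column negations and renamings of indeterminates, into a matrix having $2m$ rows of the form $$\begin{pmatrix} z_jI_m & M_j\\ -M_j^H & z_j^*I_m\end{pmatrix}\quad\text{with } M_j^T=-M_j .$$ A COD is *decomposable* if, up to the order of its rows, it is the vertical concatenation $\binom{G_1}{G_2}$ of two CODs (each with at least one indeterminate) on disjoint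 sets of indeterminates whose union is $\{z_1,\dots,z_k\}$; otherwise it is *indecomposable*. **Theorem.** Let $m\ge1$. Any two $[2^m,2m,2^{m-1}]$ BCODs are equivalent; moreover, one can be transformed into the other by equivalence operations without column negations. Consequently there is a unique indecomposable BCOD with $2m$ columns up to equivalence: there is an indecomposable $[2^m,2m,2^{m-1}]$ BCOD $G_0$, and every indecomposable $[p,2m,k]$ BCOD has $p=2^m$, $k=2^{m-1}$ and can be transformed into $G_0$ by equivalence operations, even without column negations. -/

import Mathlib

namespace COD

/-- A formal entry of a design in the complex indeterminates `z_i`, `i : Fin k`: either `0`, or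
`s * z_i` (`conj = false`), or `s * z_i^*` (`conj = true`), where `s = ±1`. -/
inductive Entry (k : ℕ) where
  | zero : Entry k
  | var (s : ℤˣ) (conj : Bool) (i : Fin k) : Entry k
  deriving DecidableEq

namespace Entry

variable {k l : ℕ}

instance : Zero (Entry k) := ⟨Entry.zero⟩

/-- The entry `z_i`. -/
def z (i : Fin k) : Entry k := Entry.var 1 false i

instance : Neg (Entry k) where
  neg
    | .zero => .zero
    | .var s b i => .var (-s) b i

/-- Complex conjugation of an entry. -/
instance : Star (Entry k) where
  star
    | .zero => .zero
    | .var s b i => .var s (!b) i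

/-- Rename the indeterminates. -/
def rename (f : Fin k → Fin l) : Entry k → Entry l
  | .zero => .zero
  | .var s b i => .var s b (f i)

/-- Negate the entry if its indeterminate is `z_i`. -/
def negVar (i : Fin k) : Entry k → Entry k
  | .zero => .zero
  | .var s b j => if j = i then .var (-s) b j else .var s b j

/-- Conjugate the entry if its indeterminate is `z_i`. -/
def conjVar (i : Fin k) : Entry k → Entry k
  | .zero => .zero
  | .var s b j => if j = i then .var s (!b) j else .var s b j

/-- The complex number obtained from an entry by giving values to the indeterminates. -/
noncomputable def eval (v : Fin k → ℂ) : Entry k → ℂ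
  | .zero => 0
  | .var s b i => ((s : ℤ) : ℂ) * (if b then star (v i) else v i)

end Entry

/-- `p × n` matrices whose entries are `0`, `± z_i` or `± z_i^*` with `i : Fin k`. -/
abbrev Design (p n k : ℕ) : Type := Matrix (Fin p) (Fin n) (Entry k)

/-- `G` is a `[p, n, k]` complex orthogonal design: there is at least one indeterminate, and
`Gᴴ G = (|z_1|² + ⋯ + |z_k|²) I_n` holds identically in the complex indeterminates. -/
def IsCOD {p n k : ℕ} (G : Design p n k) : Prop :=
  0 < k ∧ ∀ v : Fin k → ℂ,
    (G.map (Entry.eval v)).conjTranspose * G.map (Entry.eval v) =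
      ((∑ i, ‖v i‖ ^ 2 : ℝ) : ℂ) • (1 : Matrix (Fin n) (Fin n) ℂ)

/-- The elementary equivalence operations. -/
inductive Op (p n k : ℕ) where
  | rowPerm (σ : Equiv.Perm (Fin p)) : Op p n k
  | rowNeg (r : Fin p) : Op p n k
  | colPerm (σ : Equiv.Perm (Fin n)) : Op p n k
  | colNeg (c : Fin n) : Op p n k
  | instRename (τ : Equiv.Perm (Fin k)) : Op p n k
  | instNeg (i : Fin k) : Op p n k
  | instConj (i : Fin k) : Op p n k

namespace Op

variable {p n k : ℕ}

/-- The effect of an equivalence operation on a design. -/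
def apply : Op p n k → Design p n k → Design p n k
  | .rowPerm σ, G => G.submatrix σ id
  | .rowNeg r, G => Matrix.of fun r' c => if r' = r then -G r' c else G r' c
  | .colPerm σ, G => G.submatrix id σ
  | .colNeg c, G => Matrix.of fun r c' => if c' = c then -G r c' else G r c'
  | .instRename τ, G => G.map (Entry.rename τ)
  | .instNeg i, G => G.map (Entry.negVar i)
  | .instConj i, G => G.map (Entry.conjVar i)

/-- The operation is not a column negation. -/
def NotColNeg (o : Op p n k) : Prop := ∀ c, o ≠ .colNeg c

/-- The operation is not an instance renaming. -/
def NotRename (o : Op p n k) : Prop := ∀ τ, o ≠ .instRename τ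

end Op

/-- `H` is obtained from `G` by a finite sequence of operations, all satisfying `allowed`. -/
def TransformsTo {p n k : ℕ} (allowed : Op p n k → Prop) (G H : Design p n k) : Prop :=
  Relation.ReflTransGen (fun A B => ∃ o, allowed o ∧ B = o.apply A) G H

/-- Equivalence of designs: all operations are allowed. -/
def Equivalent {p n k : ℕ} (G H : Design p n k) : Prop :=
  TransformsTo (fun _ => True) G H

/-- Equivalence of designs without using column negations. -/
def EquivalentWithoutColNeg {p n k : ℕ} (G H : Design p n k) : Prop :=
  TransformsTo Op.NotColNeg G H

/-- The `2m` columns as a left half and a right half: `inl i` is column `i`, `inr i` is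
column `m + i`. -/
def halves (m : ℕ) : Fin m ⊕ Fin m ≃ Fin (2 * m) :=
  finSumFinEquiv.trans (finCongr (two_mul m).symm)

/-- `2m` rows of `G` (indexed by `f`) form the matrix
`[ z_j I_m , M ; -Mᴴ , z_j^* I_m ]` with `M` skew-symmetric. -/
def ContainsSkewB {p m k : ℕ} (j : Fin k) (G : Design p (2 * m) k) : Prop :=
  ∃ (f : Fin m ⊕ Fin m ↪ Fin p) (M : Matrix (Fin m) (Fin m) (Entry k)),
    M.transpose = -M ∧
    G.submatrix f (halves m) =
      Matrix.fromBlocks (Matrix.diagonal fun _ => Entry.z j) M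
        (-M.conjTranspose) (Matrix.diagonal fun _ => star (Entry.z j))

/-- All nonzero entries of a row are conjugated, or all are non-conjugated. -/
def ConjugationSeparated {p n k : ℕ} (G : Design p n k) : Prop :=
  ∀ r, ∃ b : Bool, ∀ c s b' i, G r c = Entry.var s b' i → b' = b

/-- Balanced complex orthogonal designs with `2m` columns. In the last condition, `G` is brought
into `B_j` form keeping the names of the indeterminates and without negating columns
(skew-symmetry of `M_j` is not invariant under column negation). -/
structure IsBCOD {p m k : ℕ} (G : Design p (2 * m) k) : Prop where
  isCOD : IsCOD G
  card_zero : ∀ r, (Finset.univ.filter fun c => G r c = 0).card = m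
  card_nonzero : ∀ r, (Finset.univ.filter fun c => G r c ≠ 0).card = m
  conjSep : ConjugationSeparated G
  skew : ∀ j : Fin k, ∃ G' : Design p (2 * m) k,
    TransformsTo (fun o => o.NotColNeg ∧ o.NotRename) G G' ∧ ContainsSkewB j G'

/-- The direct sum (vertical concatenation) of two designs on disjoint sets of indeterminates. -/
def directSum {p₁ p₂ n k₁ k₂ : ℕ} (G₁ : Design p₁ n k₁) (G₂ : Design p₂ n k₂) :
    Design (p₁ + p₂) n (k₁ + k₂) :=
  Matrix.of (Fin.append (fun r c => (G₁ r c).rename (Fin.castAdd k₂))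
    (fun r c => (G₂ r c).rename (Fin.natAdd k₁)))

/-- `G` is, up to the order of its rows and the numbering of its indeterminates, the direct sum
of two CODs. -/
def Decomposable {p n k : ℕ} (G : Design p n k) : Prop :=
  ∃ (p₁ p₂ k₁ k₂ : ℕ) (G₁ : Design p₁ n k₁) (G₂ : Design p₂ n k₂)
    (e : Fin p ≃ Fin (p₁ + p₂)) (t : Fin (k₁ + k₂) ≃ Fin k),
    IsCOD G₁ ∧ IsCOD G₂ ∧ G = ((directSum G₁ G₂).submatrix e id).map (Entry.rename t)

/-- `G` is not a direct sum of two CODs. -/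
def Indecomposable {p n k : ℕ} (G : Design p n k) : Prop := ¬ Decomposable G

/-- Transport a design along equalities of parameters. -/
def Design.cast {p p' n k k' : ℕ} (hp : p = p') (hk : k = k') (G : Design p n k) :
    Design p' n k' :=
  (G.submatrix (Fin.cast hp.symm) id).map (Entry.rename (Fin.cast hk))

end COD

/-!
The `2 * m` rows containing an indeterminate form, up to signs, a skew block, which pairs the
columns and conjugates the indeterminate in one column of each pair. Labelling the columns by a
coordinate and a sign, one reads off for each indeterminate a vertex of the `m`-cube. Two
indeterminates in a common row induce the same pairing, so within a connected component of
indeterminates the labels are consistent, and the rows without conjugated entries link vertices at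
distance two.

Skewness of the blocks says that the product of the four signs around each square of the cube is
`-1`. Koszul signs have the same property; dividing by them leaves signs with product `1` around
every square. Since the squares fill the cycles of the cube, walking from a base vertex defines a
bijection of the even vertices with the component, of the odd vertices with its rows without
conjugated entries, and a potential for the remaining signs. Hence a component looks like one
fixed model, up to signs of rows and of indeterminates, and has `2 ^ (m - 1)` indeterminates. A
design with `2 ^ (m - 1)` indeterminates, or an indecomposable one, is a single component.
-/

namespace COD

section Cube

open Finset

theorem update_induction {ι : Type*} {β : ι → Type*} [Finite ι] [DecidableEq ι]
    {P : (∀ i, β i) → Prop} (f₀ : ∀ i, β i) (base : P f₀)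
    (update : ∀ f i a, P f → P (Function.update f i a)) (f : ∀ i, β i) : P f := by
  have := Fintype.ofFinite ι
  suffices ∀ s : Finset ι, P (s.piecewise f f₀) by simpa using this univ
  intro s
  induction s using Finset.induction_on with
  | empty => simpa using base
  | insert i s _ ih => simpa only [piecewise_insert] using update _ i (f i) ih

variable {ι : Type*}

/-- The vertices of the hypercube with coordinate directions `ι`, encoded as sign vectors. -/
abbrev Cube (ι : Type*) := ι → ℤˣ

namespace Cube

/-- The neighbour of a vertex in the coordinate direction `i`. -/
def flip [DecidableEq ι] (x : Cube ι) (i : ι) : Cube ι := Pi.mulSingle i (-1) * x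

section Flip

variable [DecidableEq ι] (x : Cube ι) {i s : ι}

@[simp]
theorem flip_self (i : ι) : x.flip i i = -x i := by
  simp [flip]

@[simp]
theorem flip_of_ne (h : s ≠ i) : x.flip i s = x s := by
  simp [flip, h]

@[simp]
theorem flip_flip (i : ι) : (x.flip i).flip i = x := by
  simp [flip, ← mul_assoc, ← Pi.mulSingle_mul]

theorem flip_comm (i s : ι) : (x.flip i).flip s = (x.flip s).flip i :=
  mul_left_comm ..

theorem prod_flip [Fintype ι] (i : ι) : ∏ t, x.flip i t = -∏ t, x t := by
  simp [flip, prod_mul_distrib]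

theorem flip_induction [Finite ι] {P : Cube ι → Prop} (one : P 1)
    (flip : ∀ x i, P x → P (x.flip i)) (x : Cube ι) : P x := by
  refine update_induction 1 one (fun f i a hf => ?_) x
  obtain rfl | h := eq_or_ne a (f i)
  · simpa using hf
  · convert flip f i hf using 1
    ext1 s
    obtain rfl | hs := eq_or_ne s i
    · simpa using Int.units_ne_iff_eq_neg.mp h
    · simp [hs]

end Flip

/-- The sign at an edge in direction `i` that makes the product around each square `-1`: the
number of negative coordinates before `i` determines it, as in the Koszul complex. -/
def koszulSign [Fintype ι] [LinearOrder ι] (x : Cube ι) (i : ι) : ℤˣ := ∏ t with t < i, x t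

section KoszulSign

variable [Fintype ι] [LinearOrder ι] (x : Cube ι) {i s : ι}

theorem koszulSign_flip (i s : ι) :
    (x.flip s).koszulSign i = (if s < i then -1 else 1) * x.koszulSign i := by
  simp [koszulSign, flip, prod_mul_distrib, prod_pi_mulSingle']

@[simp]
theorem koszulSign_flip_self (i : ι) : (x.flip i).koszulSign i = x.koszulSign i := by
  simp [koszulSign_flip]

theorem koszulSign_square (h : i ≠ s) :
    x.koszulSign i * (x.flip i).koszulSign s = -(x.koszulSign s * (x.flip s).koszulSign i) := by
  rcases h.lt_or_gt with h | h <;> simp [koszulSign_flip, h, h.not_gt, mul_comm]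

end KoszulSign

end Cube

/-- The vertices with an even number of negative coordinates. -/
abbrev EvenVertex (ι : Type*) [Fintype ι] := {x : Cube ι // ∏ i, x i = 1}

/-- The vertices with an odd number of negative coordinates. -/
abbrev OddVertex (ι : Type*) [Fintype ι] := {x : Cube ι // ∏ i, x i = -1}

section Parity

variable [Fintype ι] [DecidableEq ι]

/-- The neighbour in direction `i`, from odd to even vertices. -/
def OddVertex.flip (x : OddVertex ι) (i : ι) : EvenVertex ι :=
  ⟨x.1.flip i, by rw [Cube.prod_flip, x.2, neg_neg]⟩

/-- The neighbour in direction `i`, from even to odd vertices. -/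
def EvenVertex.flip (y : EvenVertex ι) (i : ι) : OddVertex ι :=
  ⟨y.1.flip i, by rw [Cube.prod_flip, y.2]⟩

@[simp]
theorem OddVertex.coe_flip (x : OddVertex ι) (i : ι) : (x.flip i : Cube ι) = x.1.flip i := rfl

@[simp]
theorem EvenVertex.coe_flip (y : EvenVertex ι) (i : ι) : (y.flip i : Cube ι) = y.1.flip i := rfl

@[simp]
theorem OddVertex.flip_flip (x : OddVertex ι) (i : ι) : (x.flip i).flip i = x :=
  Subtype.ext (Cube.flip_flip x.1 i)

@[simp]
theorem EvenVertex.flip_flip (y : EvenVertex ι) (i : ι) : (y.flip i).flip i = y :=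
  Subtype.ext (Cube.flip_flip y.1 i)

/-- Matching of the even with the odd vertices along the edges in direction `i`. -/
@[simps]
def EvenVertex.flipEquiv (i : ι) : EvenVertex ι ≃ OddVertex ι where
  toFun y := y.flip i
  invFun x := x.flip i
  left_inv y := y.flip_flip i
  right_inv x := x.flip_flip i

theorem card_evenVertex [Nonempty ι] :
    Fintype.card (EvenVertex ι) = 2 ^ (Fintype.card ι - 1) := by
  have hcompl : Fintype.card {x : Cube ι // ¬∏ i, x i = 1} = Fintype.card (EvenVertex ι) :=
    Fintype.card_congr ((Equiv.subtypeEquivRight fun _ => Int.units_ne_iff_eq_neg).trans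
      (EvenVertex.flipEquiv (Classical.arbitrary ι)).symm)
  have hcube : Fintype.card (Cube ι) = 2 * 2 ^ (Fintype.card ι - 1) := by
    rw [mul_pow_sub_one Fintype.card_ne_zero, Fintype.card_fun, Fintype.card_units_int]
  have hsum := Fintype.card_congr (Equiv.sumCompl fun x : Cube ι => ∏ i, x i = 1)
  rw [Fintype.card_sum, hcompl, hcube] at hsum
  lia

theorem card_oddVertex [Nonempty ι] :
    Fintype.card (OddVertex ι) = 2 ^ (Fintype.card ι - 1) := by
  rw [← card_evenVertex, Fintype.card_congr (EvenVertex.flipEquiv (Classical.arbitrary ι))]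

end Parity

/-- The homomorphism sending `-1` to an involution. -/
def unitsHomOfInvolutive {X : Type*} {f : X → X} (hf : f.Involutive) : ℤˣ →* Equiv.Perm X where
  toFun u := if u = 1 then 1 else hf.toPerm
  map_one' := if_pos rfl
  map_mul' u v := by
    have : hf.toPerm * hf.toPerm = 1 := Equiv.ext hf
    rcases Int.units_eq_one_or u with rfl | rfl <;>
      rcases Int.units_eq_one_or v with rfl | rfl <;> simp [this]

theorem unitsHomOfInvolutive_neg_one {X : Type*} {f : X → X} (hf : f.Involutive) :
    unitsHomOfInvolutive hf (-1) = hf.toPerm :=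
  rfl

theorem exists_cube_map [Finite ι] [DecidableEq ι] {X : Type*} {e : ι → X → X}
    (hinv : ∀ i, (e i).Involutive) (hcomm : Pairwise fun i s => Function.Commute (e i) (e s))
    (x₀ : X) : ∃ Ψ : Cube ι → X, Ψ 1 = x₀ ∧ ∀ x i, Ψ (x.flip i) = e i (Ψ x) := by
  have := Fintype.ofFinite ι
  have hcommute : Pairwise fun i s => ∀ u v : ℤˣ,
      Commute (unitsHomOfInvolutive (hinv i) u) (unitsHomOfInvolutive (hinv s) v) := by
    intro i s his u v
    have : Commute (hinv i).toPerm (hinv s).toPerm := Equiv.ext (hcomm his)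
    rcases Int.units_eq_one_or u with rfl | rfl <;>
      rcases Int.units_eq_one_or v with rfl | rfl <;>
      simp [unitsHomOfInvolutive_neg_one, this]
  refine ⟨fun x => MonoidHom.noncommPiCoprod _ hcommute x x₀, by simp, fun x i => ?_⟩
  simp [Cube.flip, MonoidHom.noncommPiCoprod_mulSingle, unitsHomOfInvolutive_neg_one]

end Cube

section SignedCubeGraph

theorem sign_mul_eq_mul_rotate {a b c d : ℤˣ} (h : a * b = c * d) : a * c = b * d := by
  decide +revert

/-- A cubical graph with signed edges: each `v : V` has one edge in every direction `i`, ending in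
`row i v : R` and carrying `sign i v`, and each `r : R` likewise. Any two directions at `v` span a
square whose two paths to the opposite corner have opposite signs. The map `vertex` sends these
squares to squares of the cube. -/
structure SignedCubeGraph (ι V R : Type*) [DecidableEq ι] where
  row : ι → V ≃ R
  sign : ι → V → ℤˣ
  vertex : V → Cube ι
  square : ∀ v {i t}, i ≠ t → ∃ v', row i v = row t v' ∧ row t v = row i v' ∧
    vertex v' = ((vertex v).flip i).flip t ∧ sign i v * sign t v' = -(sign t v * sign i v')

namespace SignedCubeGraph

variable {ι V R : Type*} [Fintype ι] [LinearOrder ι] (S : SignedCubeGraph ι V R)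

/-- The edge sign corrected by the Koszul sign, so that squares multiply to `1`. -/
def weight (i : ι) (v : V) : ℤˣ := S.sign i v * (S.vertex v).koszulSign i

theorem exists_weight_square (v : V) {i t : ι} (hit : i ≠ t) :
    ∃ v', S.row i v = S.row t v' ∧ S.row t v = S.row i v' ∧
      S.weight i v * S.weight t v' = S.weight t v * S.weight i v' := by
  obtain ⟨v', hit', hti', hv', hsign⟩ := S.square v hit
  refine ⟨v', hit', hti', ?_⟩
  have hkoszul := (S.vertex v).koszulSign_square hit
  have hti : (S.vertex v').koszulSign t = ((S.vertex v).flip i).koszulSign t := by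
    rw [hv', Cube.koszulSign_flip_self]
  have hit : (S.vertex v').koszulSign i = ((S.vertex v).flip t).koszulSign i := by
    rw [hv', Cube.flip_comm, Cube.koszulSign_flip_self]
  rw [weight, weight, weight, weight, hti, hit, mul_mul_mul_comm,
    hsign, hkoszul, neg_mul_neg, mul_mul_mul_comm]

/-- Walking along the edge in direction `i`, while multiplying up the weights. -/
def step (i : ι) : (V ⊕ R) × ℤˣ → (V ⊕ R) × ℤˣ
  | (.inl v, u) => (.inr (S.row i v), u * S.weight i v)
  | (.inr r, u) => (.inl ((S.row i).symm r), u * S.weight i ((S.row i).symm r))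

theorem step_involutive (i : ι) : (S.step i).Involutive := by
  rintro ⟨v | r, u⟩ <;> simp [step, mul_assoc, Int.units_mul_self]

theorem step_commute : Pairwise fun i t => Function.Commute (S.step i) (S.step t) := by
  rintro i t hit ⟨v | r, u⟩
  · obtain ⟨v', hi, ht, hw⟩ := S.exists_weight_square v hit
    simp [step, hi, ht, mul_assoc, hw]
  · obtain ⟨v, rfl⟩ := (S.row t).surjective r
    obtain ⟨v', ht, hi, hw⟩ := S.exists_weight_square v hit.symm
    have hsymm : (S.row i).symm (S.row t v) = v' := by rw [ht, Equiv.symm_apply_apply]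
    simp [step, mul_assoc, hsymm, ← hi, sign_mul_eq_mul_rotate hw]

variable {S}

theorem orbit_parity {Ψ : Cube ι → (V ⊕ R) × ℤˣ} {v₀ : V} (h₁ : Ψ 1 = (.inl v₀, 1))
    (hΨ : ∀ x i, Ψ (x.flip i) = S.step i (Ψ x)) (hv₀ : S.vertex v₀ = 1) (x : Cube ι) :
    (∏ i, x i = 1 ∧ ∃ v, (Ψ x).1 = .inl v ∧ S.vertex v = x) ∨
      (∏ i, x i = -1 ∧
        ∃ r, (Ψ x).1 = .inr r ∧ ∀ i, S.vertex ((S.row i).symm r) = x.flip i) := by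
  induction x using Cube.flip_induction with
  | one => exact .inl ⟨by simp, v₀, by rw [h₁], hv₀⟩
  | flip x i ih =>
    simp only [Cube.prod_flip, hΨ]
    rcases ih with ⟨hx, v, hv, hvx⟩ | ⟨hx, r, hr, hrx⟩
    · refine .inr ⟨by rw [hx], S.row i v, by rw [← Prod.mk.eta (p := Ψ x), hv, step], fun t => ?_⟩
      obtain rfl | hit := eq_or_ne i t
      · simp [hvx]
      · obtain ⟨v', hv', -, hvertex, -⟩ := S.square v hit
        rw [hv', Equiv.symm_apply_apply, hvertex, hvx]
    · exact .inl ⟨by simp [hx], (S.row i).symm r, by rw [← Prod.mk.eta (p := Ψ x), hr, step], hrx i⟩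

variable (S) in
theorem exists_coordinate_maps {v₀ : V} (hv₀ : S.vertex v₀ = 1) :
    ∃ (Φ : EvenVertex ι → V) (A : OddVertex ι → R) (θ : Cube ι → ℤˣ),
      (∃ y, Φ y = v₀) ∧ ∀ y, S.vertex (Φ y) = y ∧ ∀ i, S.row i (Φ y) = A (y.flip i) ∧
        S.sign i (Φ y) = θ y * θ (y.1.flip i) * y.1.koszulSign i := by
  obtain ⟨Ψ, h₁, hΨ⟩ := exists_cube_map S.step_involutive S.step_commute (.inl v₀, 1)
  have hparity := orbit_parity h₁ hΨ hv₀
  have heven (y : EvenVertex ι) : ∃ v, (Ψ y).1 = .inl v ∧ S.vertex v = y :=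
    ((hparity y).resolve_right fun h => absurd (y.2.symm.trans h.1) (by decide)).2
  have hodd (x : OddVertex ι) : ∃ r, (Ψ x).1 = .inr r :=
    let ⟨_, r, hr, _⟩ := (hparity x).resolve_left fun h => absurd (h.1.symm.trans x.2) (by decide)
    ⟨r, hr⟩
  choose Φ hΦ hvertex using heven
  choose A hA using hodd
  refine ⟨Φ, A, fun x => (Ψ x).2, ⟨⟨1, by simp⟩, Sum.inl_injective (by rw [← hΦ]; simp [h₁])⟩,
    fun y => ⟨hvertex y, fun i => ?_⟩⟩
  have hΨy : Ψ y = (.inl (Φ y), (Ψ y).2) := Prod.ext (hΦ y) rfl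
  have hstep : Ψ (y.flip i).1 = S.step i (.inl (Φ y), (Ψ y).2) := hΨy ▸ hΨ y i
  have hsign : (Ψ (y.1.flip i)).2 = (Ψ y).2 * S.weight i (Φ y) := congrArg Prod.snd hstep
  refine ⟨Sum.inr_injective ((congrArg Prod.fst hstep).symm.trans (hA (y.flip i))), ?_⟩
  beta_reduce
  rw [hsign, weight, hvertex, ← mul_assoc, Int.units_mul_self, one_mul, mul_assoc,
    Int.units_mul_self, mul_one]

theorem exists_coordinates {v₀ : V} (hv₀ : S.vertex v₀ = 1)
    (hconn : ∀ v, Relation.ReflTransGen (fun v w => ∃ i t, S.row i v = S.row t w) v₀ v) :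
    ∃ (Φ : EvenVertex ι ≃ V) (A : OddVertex ι → R) (θ : Cube ι → ℤˣ), ∀ y,
      S.vertex (Φ y) = y ∧ ∀ i, S.row i (Φ y) = A (y.flip i) ∧
        S.sign i (Φ y) = θ y * θ (y.1.flip i) * y.1.koszulSign i := by
  obtain ⟨Φ, A, θ, hbase, h⟩ := S.exists_coordinate_maps hv₀
  have hrow (y i) : S.row i (Φ y) = A (y.flip i) := ((h y).2 i).1
  have hinj : Φ.Injective := fun y y' hyy' =>
    Subtype.ext (by rw [← (h y).1, hyy', (h y').1])
  have hsurj : Φ.Surjective := fun v => by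
    induction hconn v with
    | refl => exact hbase
    | tail _ hvw ih =>
      obtain ⟨⟨i, t, hit⟩, y, rfl⟩ := hvw, ih
      refine ⟨(y.flip i).flip t, (S.row t).injective ?_⟩
      rw [hrow, OddVertex.flip_flip, ← hrow, hit]
  exact ⟨.ofBijective Φ ⟨hinj, hsurj⟩, A, θ, h⟩

end SignedCubeGraph

end SignedCubeGraph

namespace Entry

variable {k l : ℕ}

@[elab_as_elim, induction_eliminator]
theorem ind {P : Entry k → Prop} (zero : P 0) (var : ∀ s b i, P (.var s b i)) (e : Entry k) :
    P e := by
  cases e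
  · exact zero
  · exact var _ _ _

theorem exists_eq_var {e : Entry k} (h : e ≠ 0) : ∃ s b i, e = .var s b i := by
  induction e with
  | zero => exact absurd rfl h
  | var s b i => exact ⟨s, b, i, rfl⟩

instance : SMul ℤˣ (Entry k) where
  smul t
    | .zero => .zero
    | .var s b i => .var (t * s) b i

section Simp

variable (s t : ℤˣ) (b : Bool) (i : Fin k) (f : Fin k → Fin l)

@[simp] protected theorem smul_zero : t • (0 : Entry k) = 0 := rfl
@[simp] theorem smul_var : t • var s b i = var (t * s) b i := rfl
@[simp] protected theorem neg_zero : -(0 : Entry k) = 0 := rfl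
@[simp] theorem neg_var : -var s b i = var (-s) b i := rfl
@[simp] protected theorem star_zero : star (0 : Entry k) = 0 := rfl
@[simp] theorem star_var : star (var s b i) = var s (!b) i := rfl
@[simp] theorem rename_zero : rename f 0 = 0 := rfl
@[simp] theorem rename_var : rename f (var s b i) = var s b (f i) := rfl
@[simp] theorem var_ne_zero : var s b i ≠ 0 := nofun
@[simp] theorem zero_ne_var : 0 ≠ var s b i := nofun

end Simp

instance : MulAction ℤˣ (Entry k) where
  one_smul e := by induction e <;> simp
  mul_smul t u e := by induction e <;> simp [mul_assoc]

instance : InvolutiveNeg (Entry k) where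
  neg_neg e := by induction e <;> simp

instance : InvolutiveStar (Entry k) where
  star_involutive e := by induction e <;> simp

protected theorem neg_smul (t : ℤˣ) (e : Entry k) : -t • e = -(t • e) := by
  induction e <;> simp

protected theorem smul_neg (t : ℤˣ) (e : Entry k) : t • -e = -(t • e) := by
  induction e <;> simp

protected theorem star_smul (t : ℤˣ) (e : Entry k) : star (t • e) = t • star e := by
  induction e <;> simp

protected theorem star_neg (e : Entry k) : star (-e) = -star e := by
  induction e <;> simp

theorem smul_smul_self (t : ℤˣ) (e : Entry k) : t • t • e = e := by
  rw [smul_smul, Int.units_mul_self, one_smul]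

theorem smul_eq_zero_iff {t : ℤˣ} {e : Entry k} : t • e = 0 ↔ e = 0 := by
  induction e <;> simp

@[simp]
protected theorem neg_eq_zero {e : Entry k} : -e = 0 ↔ e = 0 := by
  induction e <;> simp

@[simp]
protected theorem star_eq_zero {e : Entry k} : star e = 0 ↔ e = 0 := by
  induction e <;> simp

theorem eq_zero_of_eq_neg {e : Entry k} (h : e = -e) : e = 0 := by
  induction e with
  | zero => rfl
  | var s b i => exact absurd (var.inj h).1 (units_ne_neg_self s)

section Eval

variable (v : Fin k → ℂ)

@[simp] theorem eval_zero : eval v 0 = 0 := rfl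

theorem eval_star (e : Entry k) : eval v (star e) = star (eval v e) := by
  induction e with
  | zero => simp
  | var s b i => cases b <;> simp [eval]

theorem eval_smul (t : ℤˣ) (e : Entry k) : eval v (t • e) = ((t : ℤ) : ℂ) * eval v e := by
  induction e with
  | zero => simp
  | var s b i => simp [eval, mul_assoc]

theorem star_eval_mul_eval_var (s : ℤˣ) (b : Bool) (i : Fin k) :
    star (eval v (var s b i)) * eval v (var s b i) = ((‖v i‖ ^ 2 : ℝ) : ℂ) := by
  rw [← Complex.normSq_eq_norm_sq, Complex.normSq_eq_conj_mul_self]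
  rcases Int.units_eq_one_or s with rfl | rfl <;> cases b <;> simp [eval, mul_comm]

end Eval

/-- Change of signs and conjugation of the indeterminates. -/
def twist (η : Fin k → ℤˣ) (β : Fin k → Bool) : Entry k → Entry k
  | .zero => .zero
  | .var s b i => .var (η i * s) (b ^^ β i) i

section Twist

variable (η : Fin k → ℤˣ) (β : Fin k → Bool)

@[simp] theorem twist_zero : twist η β 0 = 0 := rfl
@[simp] theorem twist_var (s : ℤˣ) (b : Bool) (i : Fin k) :
    twist η β (var s b i) = var (η i * s) (b ^^ β i) i := rfl

@[simp]
theorem twist_one_false (e : Entry k) : twist 1 (fun _ => false) e = e := by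
  induction e <;> simp

@[simp]
theorem twist_twist_self (e : Entry k) : twist η β (twist η β e) = e := by
  induction e <;> simp [← mul_assoc, Int.units_mul_self]

theorem twist_smul (t : ℤˣ) (e : Entry k) : twist η β (t • e) = t • twist η β e := by
  induction e <;> simp [mul_left_comm]

theorem twist_neg (e : Entry k) : twist η β (-e) = -twist η β e := by
  induction e <;> simp

theorem twist_star (e : Entry k) : twist η β (star e) = star (twist η β e) := by
  induction e <;> simp

end Twist

end Entry

section Transformations

variable {p n k : ℕ} {G H K : Design p n k} {allowed allowed' : Op p n k → Prop}

theorem TransformsTo.refl (G : Design p n k) : TransformsTo allowed G G :=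
  Relation.ReflTransGen.refl

theorem TransformsTo.trans (h₁ : TransformsTo allowed G H) (h₂ : TransformsTo allowed H K) :
    TransformsTo allowed G K :=
  Relation.ReflTransGen.trans h₁ h₂

theorem TransformsTo.apply {o : Op p n k} (h : TransformsTo allowed G H) (ho : allowed o) :
    TransformsTo allowed G (o.apply H) :=
  .tail h ⟨o, ho, rfl⟩

theorem TransformsTo.mono (h : ∀ o, allowed o → allowed' o) (hGH : TransformsTo allowed G H) :
    TransformsTo allowed' G H :=
  Relation.ReflTransGen.mono (p := fun A B => ∃ o, allowed' o ∧ B = o.apply A)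
    (fun _ _ ⟨o, ho, e⟩ => ⟨o, h o ho, e⟩) _ _ hGH

theorem EquivalentWithoutColNeg.equivalent (h : EquivalentWithoutColNeg G H) : Equivalent G H :=
  TransformsTo.mono (fun _ _ => trivial) h

theorem transformsTo_rowSigns (hneg : ∀ r, allowed (.rowNeg r)) (G : Design p n k)
    (ρ : Fin p → ℤˣ) : TransformsTo allowed G (.of fun r c => ρ r • G r c) := by
  refine update_induction (P := fun ρ => TransformsTo allowed G (.of fun r c => (ρ r : ℤˣ) • G r c))
    1 ?_ (fun ρ r u ih => ?_) ρ
  · convert TransformsTo.refl G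
    ext r c
    simp
  · obtain rfl | h := eq_or_ne u (ρ r)
    · simpa using ih
    · rw [Int.units_ne_iff_eq_neg.mp h]
      convert ih.apply (hneg r) using 1
      ext r' c
      by_cases hr : r' = r
      · simp [Op.apply, hr, Entry.neg_smul]
      · simp [Op.apply, hr]

theorem transformsTo_indetSigns (hneg : ∀ i, allowed (.instNeg i)) (G : Design p n k)
    (η : Fin k → ℤˣ) : TransformsTo allowed G (G.map (Entry.twist η fun _ => false)) := by
  refine update_induction
    (P := fun η => TransformsTo allowed G (G.map (Entry.twist η fun _ => false)))
    1 ?_ (fun η i u ih => ?_) η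
  · convert TransformsTo.refl G
    ext r c
    simp
  · obtain rfl | h := eq_or_ne u (η i)
    · simpa using ih
    · rw [Int.units_ne_iff_eq_neg.mp h]
      convert ih.apply (hneg i) using 1
      ext r c
      simp only [Op.apply, Matrix.map_apply]
      induction G r c with
      | zero => rfl
      | var s b l => by_cases hl : l = i <;> simp [Entry.negVar, hl]

theorem transformsTo_indetConjs (hconj : ∀ i, allowed (.instConj i)) (G : Design p n k)
    (β : Fin k → Bool) : TransformsTo allowed G (G.map (Entry.twist 1 β)) := by
  refine update_induction (P := fun β => TransformsTo allowed G (G.map (Entry.twist 1 β)))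
    (fun _ => false) ?_ (fun β i b' ih => ?_) β
  · convert TransformsTo.refl G
    ext r c
    simp
  · obtain rfl | h := eq_or_ne b' (β i)
    · simpa using ih
    · rw [Bool.eq_not.mpr h]
      convert ih.apply (hconj i) using 1
      ext r c
      simp only [Op.apply, Matrix.map_apply]
      induction G r c with
      | zero => rfl
      | var s b l => by_cases hl : l = i <;> simp [Entry.conjVar, hl]

/-- Normal form of the transformations without column negations and renamings: the permutations of
rows and columns, the row signs, and the signs and conjugations of the indeterminates commute past
each other and can be collected. -/
def Similar (G H : Design p n k) : Prop :=
  ∃ (σ : Equiv.Perm (Fin p)) (κ : Equiv.Perm (Fin n)) (ρ : Fin p → ℤˣ) (η : Fin k → ℤˣ)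
    (β : Fin k → Bool), ∀ r c, H r c = ρ r • (G (σ r) (κ c)).twist η β

theorem Similar.apply (h : Similar G H) {o : Op p n k} (ho : o.NotColNeg ∧ o.NotRename) :
    Similar G (o.apply H) := by
  obtain ⟨σ, κ, ρ, η, β, h⟩ := h
  cases o with
  | rowPerm τ => exact ⟨τ.trans σ, κ, ρ ∘ τ, η, β, fun r c => by simp [Op.apply, h]⟩
  | colPerm τ => exact ⟨σ, τ.trans κ, ρ, η, β, fun r c => by simp [Op.apply, h]⟩
  | rowNeg q =>
    refine ⟨σ, κ, fun r => if r = q then -ρ r else ρ r, η, β, fun r c => ?_⟩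
    by_cases hr : r = q <;> simp [Op.apply, h, hr, Entry.neg_smul]
  | colNeg q => exact absurd rfl (ho.1 q)
  | instRename τ => exact absurd rfl (ho.2 τ)
  | instNeg j =>
    refine ⟨σ, κ, ρ, fun i => if i = j then -η i else η i, β, fun r c => ?_⟩
    simp only [Op.apply, Matrix.map_apply, h]
    induction G (σ r) (κ c) with
    | zero => rfl
    | var s b i => by_cases hi : i = j <;> simp [Entry.negVar, hi]
  | instConj j =>
    refine ⟨σ, κ, ρ, η, fun i => if i = j then !β i else β i, fun r c => ?_⟩
    simp only [Op.apply, Matrix.map_apply, h]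
    induction G (σ r) (κ c) with
    | zero => rfl
    | var s b i => by_cases hi : i = j <;> simp [Entry.conjVar, hi]

theorem transformsTo_iff_similar :
    TransformsTo (fun o => o.NotColNeg ∧ o.NotRename) G H ↔ Similar G H := by
  constructor
  · intro h
    induction h with
    | refl => exact ⟨1, 1, 1, 1, fun _ => false, by simp⟩
    | tail _ h ih =>
      obtain ⟨o, ho, rfl⟩ := h
      exact ih.apply ho
  · rintro ⟨σ, κ, ρ, η, β, h⟩
    have hrow : TransformsTo (fun o => o.NotColNeg ∧ o.NotRename) G
        (Op.apply (.rowPerm σ) G) := (TransformsTo.refl G).apply ⟨nofun, nofun⟩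
    have hperm := hrow.apply (o := .colPerm κ) ⟨nofun, nofun⟩
    have hsigns := hperm.trans (transformsTo_indetSigns (fun _ => ⟨nofun, nofun⟩) _ η)
    have hconjs := hsigns.trans (transformsTo_indetConjs (fun _ => ⟨nofun, nofun⟩) _ β)
    convert hconjs.trans (transformsTo_rowSigns (fun _ => ⟨nofun, nofun⟩) _ ρ)
    ext r c
    simp only [h, Op.apply, Matrix.of_apply, Matrix.map_apply, Matrix.submatrix_apply, id]
    induction G (σ r) (κ c) <;> simp

theorem Similar.equivalentWithoutColNeg (h : Similar G H) : EquivalentWithoutColNeg G H :=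
  (transformsTo_iff_similar.mpr h).mono fun _ ho => ho.1

end Transformations

section SkewBlock

variable {m k : ℕ} {b : Bool} {j : Fin k} {M : Matrix (Fin m) (Fin m) (Entry k)}

/-- The matrix `[z I, M; -Mᴴ, z^* I]`, where `z` is `z_j` if `b` is `false` and `z_j^*` if `b` is
`true`. -/
def skewBlock (b : Bool) (j : Fin k) (M : Matrix (Fin m) (Fin m) (Entry k)) :
    Matrix (Fin m ⊕ Fin m) (Fin m ⊕ Fin m) (Entry k) :=
  .fromBlocks (.diagonal fun _ => .var 1 b j) M (-M.conjTranspose)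
    (.diagonal fun _ => .var 1 (!b) j)

theorem skewBlock_self (a : Fin m ⊕ Fin m) :
    skewBlock b j M a a = .var 1 (b ^^ a.isRight) j := by
  cases a <;> simp [skewBlock]

theorem skewBlock_smul_twist (t : ℤˣ) (η : Fin k → ℤˣ) (β : Fin k → Bool) (a c : Fin m ⊕ Fin m) :
    (η j * t) • (t • skewBlock b j M a c).twist η β =
      skewBlock (b ^^ β j) j (.of fun i l => η j • (M i l).twist η β) a c := by
  rw [Entry.twist_smul, smul_smul, mul_assoc, Int.units_mul_self, mul_one]
  rcases a with a | a <;> rcases c with c | c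
  · obtain rfl | hac := eq_or_ne a c <;> simp_all [skewBlock, Int.units_mul_self]
  · simp [skewBlock]
  · simp [skewBlock, Entry.twist_neg, Entry.twist_star, Entry.smul_neg, Entry.star_smul]
  · obtain rfl | hac := eq_or_ne a c <;> simp_all [skewBlock, Int.units_mul_self]

variable (hM : M.transpose = -M)

include hM

theorem skew_apply (i l : Fin m) : M l i = -M i l :=
  congrFun₂ hM i l

theorem skew_apply_self (i : Fin m) : M i i = 0 :=
  Entry.eq_zero_of_eq_neg (skew_apply hM i i)

theorem skewBlock_swap_swap (a c : Fin m ⊕ Fin m) :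
    skewBlock b j M a.swap c.swap = star (skewBlock b j M a c) := by
  rcases a with a | a <;> rcases c with c | c
  · obtain rfl | hac := eq_or_ne a c <;> simp_all [skewBlock]
  · simp [skewBlock, skew_apply hM a c, Entry.star_neg]
  · simp [skewBlock, skew_apply hM a c, Entry.star_neg]
  · obtain rfl | hac := eq_or_ne a c <;> simp_all [skewBlock]

theorem skewBlock_swap_eq_neg {a c : Fin m ⊕ Fin m} (h : c.isRight = a.isRight) :
    skewBlock b j M a c.swap = -skewBlock b j M c a.swap := by
  rcases a with a | a <;> rcases c with c | c
  · simp [skewBlock, skew_apply hM c a]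
  · simp at h
  · simp at h
  · simp [skewBlock, skew_apply hM c a, Entry.star_neg]

theorem skew_ne_zero_of_card {i l : Fin m}
    (hcard : (Finset.univ.filter fun c => skewBlock b j M (.inl i) c ≠ 0).card = m) (hil : i ≠ l) :
    M i l ≠ 0 := by
  have hsplit : 1 + (Finset.univ.filter fun l => M i l ≠ 0).card = m := by
    refine Eq.trans ?_ hcard
    rw [Finset.card_filter, Finset.card_filter, Fintype.sum_sum_type]
    congr 1
    rw [Finset.sum_eq_single i (fun c _ hc => by simp_all [skewBlock, Matrix.diagonal_apply_ne'])]
      <;> simp [skewBlock]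
  have hsub : (Finset.univ.filter fun l => M i l ≠ 0) ⊆ Finset.univ.erase i := fun c hc =>
    Finset.mem_erase.mpr ⟨fun h => (Finset.mem_filter.mp hc).2 (h ▸ skew_apply_self hM i),
      Finset.mem_univ c⟩
  have heq := Finset.eq_of_subset_of_card_le hsub (by simp; lia)
  have hl : l ∈ Finset.univ.filter fun l => M i l ≠ 0 := by simp [heq, hil.symm]
  exact (Finset.mem_filter.mp hl).2

theorem skewBlock_ne_zero_iff (hM₀ : ∀ i l, i ≠ l → M i l ≠ 0) (a c : Fin m ⊕ Fin m) :
    skewBlock b j M a c ≠ 0 ↔ c = a ∨ c.isRight ≠ a.isRight ∧ c ≠ a.swap := by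
  rcases a with a | a <;> rcases c with c | c <;> obtain rfl | hac := eq_or_ne a c
  all_goals simp_all [skewBlock, skew_apply_self hM, Ne.symm]

end SkewBlock

section BlockForm

variable {p m k : ℕ} {G : Design p (2 * m) k}

/-- The two halves of the columns of a skew block, matched with the two signs: `inl i` is the
column `(i, -y i)` and `inr i` is the column `(i, y i)`. -/
def vertexHalves (y : Cube (Fin m)) : Fin m ⊕ Fin m ≃ Fin m × ℤˣ where
  toFun := Sum.elim (fun i => (i, -y i)) (fun i => (i, y i))
  invFun q := if q.2 = y q.1 then .inr q.1 else .inl q.1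
  left_inv := by rintro (i | i) <;> simp [(units_ne_neg_self (y i)).symm]
  right_inv := by
    rintro ⟨i, a⟩
    by_cases h : a = y i
    · simp [h]
    · simp [h, ← Int.units_ne_iff_eq_neg.mp h]

theorem vertexHalves_swap (y : Cube (Fin m)) (a : Fin m ⊕ Fin m) :
    vertexHalves y a.swap = ((vertexHalves y a).1, -(vertexHalves y a).2) := by
  cases a <;> simp [vertexHalves]

open Classical in
theorem Entry.star_mul_eval_single (e : Entry k) (j : Fin k) :
    star (e.eval (Pi.single j 1)) * e.eval (Pi.single j 1) =
      if ∃ s b, e = .var s b j then 1 else 0 := by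
  induction e with
  | zero => simp
  | var s b i =>
    rw [star_eval_mul_eval_var]
    obtain rfl | hij := eq_or_ne i j <;> simp [*]

theorem IsCOD.existsUnique_row {n : ℕ} {G : Design p n k} (hG : IsCOD G) (j : Fin k) (c : Fin n) :
    ∃! r, ∃ s b, G r c = .var s b j := by
  classical
  have hcol := congrFun₂ (hG.2 (Pi.single j 1)) c c
  have hnorm : ∑ i, ‖(Pi.single j 1 : Fin k → ℂ) i‖ ^ 2 = 1 := by
    rw [Finset.sum_eq_single j (by simp_all) (by simp)]
    simp
  simp only [Matrix.mul_apply, Matrix.conjTranspose_apply, Matrix.map_apply, hnorm,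
    Entry.star_mul_eval_single, Matrix.smul_apply, Matrix.one_apply_eq, Finset.sum_boole,
    Complex.ofReal_one, one_smul] at hcol
  exact (Fintype.existsUnique_iff_card_one _).mpr (by exact_mod_cast hcol)

theorem IsBCOD.exists_block (hG : IsBCOD G) (j : Fin k) :
    ∃ (f : Fin m ⊕ Fin m → Fin p) (h : Fin m ⊕ Fin m ≃ Fin (2 * m)) (s : Fin m ⊕ Fin m → ℤˣ)
      (b : Bool) (M : Matrix (Fin m) (Fin m) (Entry k)),
      M.transpose = -M ∧ ∀ a c, G (f a) (h c) = s a • skewBlock b j M a c := by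
  obtain ⟨G', hGG', f, M, hM, hblock⟩ := hG.skew j
  obtain ⟨σ, κ, ρ, η, β, hG'⟩ := transformsTo_iff_similar.mp hGG'
  refine ⟨σ ∘ f, (halves m).trans κ, fun a => η j * ρ (f a), false ^^ β j,
    .of fun i l => η j • (M i l).twist η β, ?_, fun a c => ?_⟩
  · ext i l
    simp [skew_apply hM i l, Entry.twist_neg, Entry.smul_neg]
  · rw [← skewBlock_smul_twist (ρ (f a))]
    have hB : skewBlock false j M a c =
        ρ (f a) • (G (σ (f a)) (κ (halves m c))).twist η β :=
      (congrFun₂ hblock a c).symm.trans (hG' _ _)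
    rw [Entry.smul_smul_self, hB, Entry.smul_smul_self, Entry.twist_twist_self]
    rfl

theorem IsBCOD.card_nonzero_block (hG : IsBCOD G) {f : Fin m ⊕ Fin m → Fin p}
    {h : Fin m ⊕ Fin m ≃ Fin (2 * m)} {s : Fin m ⊕ Fin m → ℤˣ}
    {B : Matrix (Fin m ⊕ Fin m) (Fin m ⊕ Fin m) (Entry k)}
    (hGB : ∀ a c, G (f a) (h c) = s a • B a c) (a : Fin m ⊕ Fin m) :
    (Finset.univ.filter fun c => B a c ≠ 0).card = m :=
  (Finset.card_equiv h (by simp [hGB, Entry.smul_eq_zero_iff])).trans (hG.card_nonzero (f a))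

/-- The shape of the rows of `G` containing `z_j`. In column `c` it occurs in row `row c`, with
sign `sign c`, and it is conjugated if and only if `conj c`. The columns are labelled by
`Fin m × ℤˣ` so that `(i, a)` and `(i, -a)` belong to the same row of the matrix `M_j` of the
BCOD, and `a` tells whether `z_j` is conjugated. -/
structure BlockForm (G : Design p (2 * m) k) (j : Fin k) where
  row : Fin (2 * m) → Fin p
  sign : Fin (2 * m) → ℤˣ
  conj : Fin (2 * m) → Bool
  pair : Fin (2 * m) → Fin (2 * m)
  chart : Fin m × ℤˣ ≃ Fin (2 * m)
  eq_var_iff : ∀ {r c s b}, G r c = .var s b j ↔ row c = r ∧ sign c = s ∧ conj c = b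
  conj_eq : ∀ {c x s b l}, G (row c) x = .var s b l → b = conj c
  ne_zero_iff : ∀ c x, G (row c) x ≠ 0 ↔ x = c ∨ conj x ≠ conj c ∧ x ≠ pair c
  conj_chart : ∀ i a, conj (chart (i, a)) = decide (a = 1)
  pair_chart : ∀ i a, pair (chart (i, a)) = chart (i, -a)
  skew : ∀ {c d}, conj d = conj c →
    sign c • G (row c) (pair d) = -(sign d • G (row d) (pair c))
  star_eq : ∀ c d, sign (pair c) • G (row (pair c)) (pair d) = star (sign c • G (row c) d)

theorem IsBCOD.nonempty_blockForm (hG : IsBCOD G) (j : Fin k) : Nonempty (BlockForm G j) := by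
  obtain ⟨f, h, s, b, M, hM, hGB⟩ := hG.exists_block j
  have hself (a) : G (f a) (h a) = .var (s a) (b ^^ a.isRight) j := by
    simp [hGB, skewBlock_self]
  have hM₀ := fun i l => skew_ne_zero_of_card hM (hG.card_nonzero_block hGB (.inl i)) (l := l)
  let y : Cube (Fin m) := fun _ => if b then -1 else 1
  exact ⟨{
    row c := f (h.symm c)
    sign c := s (h.symm c)
    conj c := b ^^ (h.symm c).isRight
    pair c := h (h.symm c).swap
    chart := (vertexHalves y).symm.trans h
    eq_var_iff {r c s' b'} := by
      obtain ⟨a, rfl⟩ := h.surjective c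
      rw [Equiv.symm_apply_apply]
      refine ⟨fun hr => ?_, by rintro ⟨rfl, rfl, rfl⟩; exact hself a⟩
      obtain rfl := (hG.isCOD.existsUnique_row j (h a)).unique ⟨_, _, hself a⟩ ⟨_, _, hr⟩
      simpa [hself] using hr
    conj_eq {c x s' b' l} hx := by
      obtain ⟨a, rfl⟩ := h.surjective c
      obtain ⟨b'', hb⟩ := hG.conjSep (f a)
      rw [Equiv.symm_apply_apply] at hx ⊢
      rw [hb _ _ _ _ hx, hb _ _ _ _ (hself a)]
    ne_zero_iff c x := by
      obtain ⟨a, rfl⟩ := h.surjective c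
      obtain ⟨d, rfl⟩ := h.surjective x
      simp [hGB, Entry.smul_eq_zero_iff, skewBlock_ne_zero_iff hM hM₀]
    conj_chart i a := by
      rcases Int.units_eq_one_or a with rfl | rfl <;> cases b <;> simp [vertexHalves, y]
    pair_chart i a := by
      simp only [Equiv.trans_apply, Equiv.symm_apply_apply, EmbeddingLike.apply_eq_iff_eq,
        Equiv.eq_symm_apply, vertexHalves_swap, Equiv.apply_symm_apply]
    skew {c d} hdc := by
      obtain ⟨a, rfl⟩ := h.surjective c
      obtain ⟨d, rfl⟩ := h.surjective d
      simp only [Equiv.symm_apply_apply, hGB, Entry.smul_smul_self] at hdc ⊢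
      exact skewBlock_swap_eq_neg hM (by simpa using hdc)
    star_eq c d := by
      obtain ⟨a, rfl⟩ := h.surjective c
      obtain ⟨d, rfl⟩ := h.surjective d
      simp only [Equiv.symm_apply_apply, hGB, Entry.smul_smul_self, skewBlock_swap_swap hM] }⟩

end BlockForm

section Pairing

variable {p m k : ℕ} {G : Design p (2 * m) k} {j l : Fin k}

namespace BlockForm

variable (F : BlockForm G j) (F' : BlockForm G l)

theorem apply_row_self (c : Fin (2 * m)) : G (F.row c) c = .var (F.sign c) (F.conj c) j :=
  F.eq_var_iff.mpr ⟨rfl, rfl, rfl⟩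

@[simp]
theorem pair_pair (c : Fin (2 * m)) : F.pair (F.pair c) = c := by
  obtain ⟨⟨i, a⟩, rfl⟩ := F.chart.surjective c
  simp [F.pair_chart]

@[simp]
theorem conj_pair (c : Fin (2 * m)) : F.conj (F.pair c) = !F.conj c := by
  obtain ⟨⟨i, a⟩, rfl⟩ := F.chart.surjective c
  rcases Int.units_eq_one_or a with rfl | rfl <;> simp [F.pair_chart, F.conj_chart]

theorem pair_eq_iff {c d : Fin (2 * m)} : F.pair c = d ↔ c = F.pair d :=
  ⟨fun h => by rw [← h, pair_pair], fun h => by rw [h, pair_pair]⟩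

theorem apply_pair_eq_zero_iff (c x : Fin (2 * m)) :
    G (F.row c) (F.pair x) = 0 ↔ G (F.row c) x ≠ 0 := by
  have hx := F.ne_zero_iff c x
  have hpair := F.ne_zero_iff c (F.pair x)
  have hself := F.conj_pair c
  simp only [ne_eq, conj_pair, pair_eq_iff, pair_pair] at hx hpair ⊢
  grind

variable {F F'}

theorem row_pair_eq {c d : Fin (2 * m)} (h : F.row c = F'.row d) :
    F'.row (F.pair d) = F.row (F.pair c) ∧
      F'.sign (F.pair d) = F.sign (F.pair c) * F.sign c * F'.sign d ∧
      F'.conj (F.pair d) = !F'.conj d := by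
  refine F'.eq_var_iff.mp ?_
  rw [← Entry.smul_smul_self (F.sign (F.pair c)) (G _ _), F.star_eq, h, F'.apply_row_self]
  simp [mul_assoc]

theorem pair_apply_eq_of_row_eq {c d : Fin (2 * m)} (h : F.row c = F'.row d) :
    F'.pair d = F.pair d := by
  by_contra hne
  have hzero : G (F'.row d) (F.pair d) = 0 := by
    rw [← h, F.apply_pair_eq_zero_iff, h, F'.apply_row_self]
    exact Entry.var_ne_zero _ _ _
  exact (F'.ne_zero_iff d _).mpr (.inr ⟨by simp [(row_pair_eq h).2.2], Ne.symm hne⟩) hzero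

/-- In each column `x` where the common row is nonzero, both pairings agree with the pairing of the
indeterminate in that column. -/
theorem pair_eq_of_row_eq (B : ∀ j, BlockForm G j) {c d : Fin (2 * m)}
    (h : (B j).row c = (B l).row d) : (B l).pair = (B j).pair := by
  have hsupport {x} (hx : G ((B j).row c) x ≠ 0) : (B l).pair x = (B j).pair x := by
    obtain ⟨s, b, u, hu⟩ := Entry.exists_eq_var hx
    have hrow := ((B u).eq_var_iff.mp hu).1
    rw [← pair_apply_eq_of_row_eq hrow.symm, pair_apply_eq_of_row_eq (h.symm.trans hrow.symm)]
  funext x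
  by_cases hx : G ((B j).row c) x = 0
  · rw [pair_eq_iff, hsupport (by simpa [apply_pair_eq_zero_iff, not_not] using hx)]
    simp
  · exact hsupport hx

end BlockForm

end Pairing

section Components

variable {p n k : ℕ}

/-- The indeterminate `z_j` occurs in row `r`. -/
def OccursIn (G : Design p n k) (j : Fin k) (r : Fin p) : Prop := ∃ c s b, G r c = .var s b j

/-- Two indeterminates occur in a common row. -/
def Shares (G : Design p n k) (j l : Fin k) : Prop := ∃ r, OccursIn G j r ∧ OccursIn G l r

/-- The graph on the indeterminates, with edges between those that occur in a common row, is
connected. -/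
def Connected (G : Design p n k) : Prop := ∀ j l, Relation.ReflTransGen (Shares G) j l

namespace BlockForm

variable {m : ℕ} {G : Design p (2 * m) k} {j l : Fin k}

theorem occursIn_row (F : BlockForm G j) (c : Fin (2 * m)) : OccursIn G j (F.row c) :=
  ⟨c, _, _, F.apply_row_self c⟩

theorem exists_row_eq_of_shares (F : BlockForm G j) (F' : BlockForm G l) (h : Shares G j l) :
    ∃ c d, F.row c = F'.row d := by
  obtain ⟨r, ⟨c, s, b, hc⟩, d, s', b', hd⟩ := h
  exact ⟨c, d, (F.eq_var_iff.mp hc).1.trans (F'.eq_var_iff.mp hd).1.symm⟩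

theorem pair_eq_of_reflTransGen (B : ∀ j, BlockForm G j)
    (h : Relation.ReflTransGen (Shares G) j l) : (B l).pair = (B j).pair := by
  induction h with
  | refl => rfl
  | tail _ hshares ih =>
    obtain ⟨c, d, hrow⟩ := (B _).exists_row_eq_of_shares (B _) hshares
    rw [pair_eq_of_row_eq B hrow, ih]

end BlockForm

end Components

section ComponentGraph

theorem decide_eq_decide_neg_one_iff {a b v : ℤˣ} :
    decide (a = v) = decide (b = -1) ↔ a = -b * v := by
  decide +revert

variable {p m k : ℕ} {G : Design p (2 * m) k} {j l : Fin k}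

namespace BlockForm

/-- In the columns labelled by `C`, the pairing of `z_j` is the change of the sign. -/
def PairsBy (F : BlockForm G j) (C : Fin m × ℤˣ ≃ Fin (2 * m)) : Prop :=
  ∀ i a, F.pair (C (i, a)) = C (i, -a)

/-- The vertex of the cube recording where `z_j` is conjugated, namely in the columns
`C (i, F.vertex C i)`. -/
def vertex (F : BlockForm G j) (C : Fin m × ℤˣ ≃ Fin (2 * m)) : Cube (Fin m) :=
  fun i => if F.conj (C (i, 1)) then 1 else -1

/-- The column among `C (i, ±1)` where `z_j` is not conjugated if `b = 1` and conjugated if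
`b = -1`. -/
def column (F : BlockForm G j) (C : Fin m × ℤˣ ≃ Fin (2 * m)) (i : Fin m) (b : ℤˣ) : Fin (2 * m) :=
  C (i, -b * F.vertex C i)

variable {F : BlockForm G j} {F' : BlockForm G l} {C : Fin m × ℤˣ ≃ Fin (2 * m)}
  {i t : Fin m} {a b b' : ℤˣ}

theorem exists_eq_column (F : BlockForm G j) (C : Fin m × ℤˣ ≃ Fin (2 * m)) (x : Fin (2 * m)) :
    ∃ i b, x = F.column C i b := by
  obtain ⟨⟨i, a⟩, rfl⟩ := C.surjective x
  exact ⟨i, -a * F.vertex C i, by simp [column, mul_assoc, Int.units_mul_self]⟩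

theorem vertex_chart (F : BlockForm G j) : F.vertex F.chart = 1 := by
  funext i
  simp [vertex, conj_chart]

section PairsBy

variable (hF : F.PairsBy C)

include hF

theorem PairsBy.conj_apply (i : Fin m) (a : ℤˣ) :
    F.conj (C (i, a)) = decide (a = F.vertex C i) := by
  have hpair := F.conj_pair (C (i, 1))
  rw [hF] at hpair
  rcases Int.units_eq_one_or a with rfl | rfl
  · cases h : F.conj (C (i, 1)) <;> simp [vertex, h]
  · rw [hpair]
    cases h : F.conj (C (i, 1)) <;> simp [vertex, h]

theorem PairsBy.conj_column (i : Fin m) (b : ℤˣ) :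
    F.conj (F.column C i b) = decide (b = -1) := by
  rw [column, hF.conj_apply]
  rcases Int.units_eq_one_or b with rfl | rfl <;> simp [(units_ne_neg_self _).symm]

theorem PairsBy.pair_column (i : Fin m) (b : ℤˣ) :
    F.pair (F.column C i b) = F.column C i (-b) := by
  simp [column, hF i]

theorem PairsBy.ne_zero_iff (i : Fin m) (b : ℤˣ) (t : Fin m) (a : ℤˣ) :
    G (F.row (F.column C i b)) (C (t, a)) ≠ 0 ↔ a = b * (F.vertex C).flip i t := by
  rw [F.ne_zero_iff, hF.pair_column, hF.conj_column, hF.conj_apply]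
  obtain rfl | hti := eq_or_ne t i
  · simp only [column, ne_eq, decide_eq_decide_neg_one_iff, EmbeddingLike.apply_eq_iff_eq,
      Prod.mk.injEq, true_and, Int.units_ne_iff_eq_neg, neg_mul, neg_neg, Cube.flip_self, mul_neg]
    exact or_iff_left_of_imp And.right
  · simp only [column, ne_eq, decide_eq_decide_neg_one_iff, EmbeddingLike.apply_eq_iff_eq,
      Prod.mk.injEq, hti, false_and, not_false_eq_true, and_true, false_or,
      Int.units_ne_iff_eq_neg, neg_mul, neg_neg, Cube.flip_of_ne _ hti]

theorem PairsBy.row_column_neg (h : F.row (F.column C i b) = F'.row (F'.column C t b)) :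
    F'.row (F'.column C t (-b)) = F.row (F.column C i (-b)) ∧
      F'.sign (F'.column C t (-b)) =
        F.sign (F.column C i (-b)) * F.sign (F.column C i b) * F'.sign (F'.column C t b) := by
  have hpair : F.pair (F'.column C t b) = F'.column C t (-b) := by simp [column, hF t]
  rw [← hpair, ← hF.pair_column]
  exact ⟨(row_pair_eq h).1, (row_pair_eq h).2.1⟩

variable (hF' : F'.PairsBy C)

include hF'

theorem PairsBy.sign_eq_of_row_eq (h : F.row (F.column C i b) = F'.row (F'.column C t b')) :
    b = b' := by
  have hconj := F.conj_eq (h ▸ F'.apply_row_self _)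
  rw [hF'.conj_column, hF.conj_column, decide_eq_decide_neg_one_iff] at hconj
  simpa using hconj.symm

theorem PairsBy.flip_eq_of_row_eq (h : F.row (F.column C i b) = F'.row (F'.column C t b)) :
    (F.vertex C).flip i = (F'.vertex C).flip t := by
  funext s
  have hne := hF.ne_zero_iff i b s (b * (F.vertex C).flip i s)
  rw [h, hF'.ne_zero_iff] at hne
  exact mul_left_cancel (hne.mpr rfl)

theorem PairsBy.eq_column_of_eq_var {s : ℤˣ} {e : Bool}
    (h : G (F.row (F.column C i b)) (C (t, a)) = .var s e l) : C (t, a) = F'.column C t b := by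
  have hconj := (F'.eq_var_iff.mp h).2.2
  rw [F.conj_eq h, hF.conj_column, hF'.conj_apply, decide_eq_decide_neg_one_iff] at hconj
  exact congrArg (fun a => C (t, a)) hconj

theorem PairsBy.exists_row_column_one_eq (h : Shares G j l) :
    ∃ i t, F.row (F.column C i 1) = F'.row (F'.column C t 1) := by
  obtain ⟨c, d, hrow⟩ := F.exists_row_eq_of_shares F' h
  obtain ⟨i, b, rfl⟩ := F.exists_eq_column C c
  obtain ⟨t, b', rfl⟩ := F'.exists_eq_column C d
  obtain rfl := hF.sign_eq_of_row_eq hF' hrow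
  refine ⟨i, t, ?_⟩
  rcases Int.units_eq_one_or b with rfl | rfl
  · exact hrow
  · simpa using (hF.row_column_neg hrow).1.symm

end PairsBy

theorem PairsBy.exists_square {B : ∀ j, BlockForm G j} (hj : (B j).PairsBy C)
    (hC : ∀ l, Shares G j l → (B l).PairsBy C) (hit : i ≠ t) :
    ∃ l, Shares G j l ∧ (B j).row ((B j).column C i 1) = (B l).row ((B l).column C t 1) ∧
      (B j).row ((B j).column C t 1) = (B l).row ((B l).column C i 1) ∧
      (B l).vertex C = (((B j).vertex C).flip i).flip t ∧
      (B j).sign ((B j).column C i 1) * (B l).sign ((B l).column C t 1) =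
        -((B j).sign ((B j).column C t 1) * (B l).sign ((B l).column C i 1)) := by
  have hne : G ((B j).row ((B j).column C i 1)) ((B j).column C t (-1)) ≠ 0 :=
    (hj.ne_zero_iff i 1 t _).mpr (by simp [hit.symm])
  obtain ⟨s, e, l, hs⟩ := Entry.exists_eq_var hne
  have hskew := (B j).skew ((hj.conj_column t 1).trans (hj.conj_column i 1).symm)
  rw [hj.pair_column, hj.pair_column, hs] at hskew
  have hs' : G ((B j).row ((B j).column C t 1)) ((B j).column C i (-1)) =
      .var (-((B j).sign ((B j).column C t 1) * (B j).sign ((B j).column C i 1) * s)) e l := by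
    rw [← Entry.smul_smul_self ((B j).sign ((B j).column C t 1)) (G _ _), ← neg_neg (_ • G _ _),
      ← hskew]
    simp [mul_assoc]
  have hshares : Shares G j l := ⟨_, (B j).occursIn_row _, _, _, _, hs⟩
  have hl := hC l hshares
  have hcol : (B j).column C t (-1) = (B l).column C t 1 := hj.eq_column_of_eq_var hl hs
  have hcol' : (B j).column C i (-1) = (B l).column C i 1 := hj.eq_column_of_eq_var hl hs'
  rw [hcol] at hs
  rw [hcol'] at hs'
  obtain ⟨hrow, hsign, -⟩ := (B l).eq_var_iff.mp hs
  obtain ⟨hrow', hsign', -⟩ := (B l).eq_var_iff.mp hs'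
  refine ⟨l, hshares, hrow.symm, hrow'.symm, ?_, ?_⟩
  · rw [hj.flip_eq_of_row_eq hl hrow.symm, Cube.flip_flip]
  · simp [hsign, hsign', ← mul_assoc, Int.units_mul_self]

section Component

variable (B : ∀ j, BlockForm G j) (j₀ : Fin k)

/-- The indeterminates in the connected component of `z_{j₀}`. -/
abbrev Component (G : Design p (2 * m) k) (j₀ : Fin k) :=
  {l // Relation.ReflTransGen (Shares G) j₀ l}

variable {j₀} in
theorem pairsBy_component (l : Component G j₀) : (B l).PairsBy (B j₀).chart := fun i a => by
  rw [pair_eq_of_reflTransGen B l.2, pair_chart]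

/-- The row without conjugated entries in which `z_l` occurs in one of the columns with label
`(i, ±1)`. -/
def plainRow (i : Fin m) (l : Component G j₀) : Fin p := (B l).row ((B l).column (B j₀).chart i 1)

theorem plainRow_injective (i : Fin m) : (plainRow B j₀ i).Injective := by
  intro v w hvw
  have hvertex := (pairsBy_component B v).flip_eq_of_row_eq (pairsBy_component B w) hvw
  have hcol : (B v).column (B j₀).chart i 1 = (B w).column (B j₀).chart i 1 := by
    rw [column, column, ← ((B v).vertex _).flip_flip i, hvertex, Cube.flip_flip]
  have hvar : G (plainRow B j₀ i v) _ = _ :=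
    (B v).apply_row_self ((B v).column (B j₀).chart i 1)
  rw [hvw, hcol, plainRow, (B w).apply_row_self] at hvar
  exact Subtype.ext (Entry.var.inj hvar).2.2.symm

theorem exists_plainRow_eq (i t : Fin m) (l : Component G j₀) :
    ∃ v, plainRow B j₀ i v = plainRow B j₀ t l := by
  obtain ⟨s, e, v, hv⟩ :=
    Entry.exists_eq_var (((pairsBy_component B l).ne_zero_iff t 1 i _).mpr rfl)
  let v' : Component G j₀ := ⟨v, l.2.tail ⟨_, (B l).occursIn_row _, _, _, _, hv⟩⟩
  have hcol := (pairsBy_component B l).eq_column_of_eq_var (pairsBy_component B v') hv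
  rw [hcol] at hv
  exact ⟨v', ((B v).eq_var_iff.mp hv).1⟩

/-- The signed cube graph of a connected component, whose edges are the nonzero entries in the rows
without conjugated entries. -/
noncomputable def componentGraph :
    SignedCubeGraph (Fin m) (Component G j₀) {r // ∃ i l, plainRow B j₀ i l = r} where
  row i := .ofBijective (fun l => ⟨plainRow B j₀ i l, i, l, rfl⟩)
    ⟨fun _ _ h => plainRow_injective B j₀ i (congrArg Subtype.val h), by
      rintro ⟨_, t, l, rfl⟩
      obtain ⟨v, hv⟩ := exists_plainRow_eq B j₀ i t l
      exact ⟨v, Subtype.ext hv⟩⟩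
  sign i l := (B l).sign ((B l).column (B j₀).chart i 1)
  vertex l := (B l).vertex (B j₀).chart
  square l i t hit := by
    obtain ⟨v, hv, hit, hti, h⟩ := (pairsBy_component B l).exists_square
      (fun v hv => pairsBy_component B ⟨v, l.2.tail hv⟩) hit
    exact ⟨⟨v, l.2.tail hv⟩, Subtype.ext hit, Subtype.ext hti, h⟩

theorem componentGraph_connected (l : Component G j₀) :
    Relation.ReflTransGen
      (fun v w => ∃ i t, (componentGraph B j₀).row i v = (componentGraph B j₀).row t w)
      ⟨j₀, .refl⟩ l := by
  obtain ⟨l, hl⟩ := l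
  induction hl with
  | refl => exact .refl
  | tail hv hvw ih =>
    obtain ⟨i, t, h⟩ := (pairsBy_component B ⟨_, hv⟩).exists_row_column_one_eq
      (pairsBy_component B ⟨_, hv.tail hvw⟩) hvw
    exact ih.tail ⟨i, t, Subtype.ext h⟩

theorem exists_component_coordinates (i₀ : Fin m) :
    ∃ (Φ : EvenVertex (Fin m) ≃ Component G j₀) (A : OddVertex (Fin m) × ℤˣ → Fin p)
      (ρ : OddVertex (Fin m) × ℤˣ → ℤˣ) (η : EvenVertex (Fin m) → ℤˣ),
      ∀ y, (B (Φ y)).vertex (B j₀).chart = y ∧ ∀ i b,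
        (B (Φ y)).row ((B (Φ y)).column (B j₀).chart i b) = A (y.flip i, b) ∧
          (B (Φ y)).sign ((B (Φ y)).column (B j₀).chart i b) =
            ρ (y.flip i, b) * (η y * y.1.koszulSign i) := by
  obtain ⟨Φ, A, θ, h⟩ := (componentGraph B j₀).exists_coordinates (v₀ := ⟨j₀, .refl⟩)
    (vertex_chart _) (componentGraph_connected B j₀)
  have hrow (y i) : plainRow B j₀ i (Φ y) = A (y.flip i) := congrArg Subtype.val ((h y).2 i).1
  have hsign (y i) : (B (Φ y)).sign ((B (Φ y)).column (B j₀).chart i 1) =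
    θ y * θ (y.1.flip i) * y.1.koszulSign i := ((h y).2 i).2
  let col (q : OddVertex (Fin m) × ℤˣ) (b : ℤˣ) :=
    (B (Φ (q.1.flip i₀))).column (B j₀).chart i₀ b
  refine ⟨Φ, fun q => (B (Φ (q.1.flip i₀))).row (col q q.2),
    fun q => (B (Φ (q.1.flip i₀))).sign (col q q.2) *
      (B (Φ (q.1.flip i₀))).sign (col q 1) * θ q.1, fun y => θ y,
    fun y => ⟨(h y).1, fun i b => ?_⟩⟩
  have hplain : plainRow B j₀ i₀ (Φ ((y.flip i).flip i₀)) = plainRow B j₀ i (Φ y) := by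
    rw [hrow, hrow, OddVertex.flip_flip]
  rcases Int.units_eq_one_or b with rfl | rfl
  · refine ⟨hplain.symm, ?_⟩
    beta_reduce
    rw [hsign y, Int.units_mul_self, one_mul, ← mul_assoc, mul_comm (θ y)]
    rfl
  · obtain ⟨hrow', hsign'⟩ := (pairsBy_component B _).row_column_neg hplain
    refine ⟨hrow', hsign'.trans ?_⟩
    beta_reduce
    rw [hsign y, mul_assoc (_ * _), ← mul_assoc (θ _), mul_comm (θ y)]
    rfl

end Component

end BlockForm

end ComponentGraph

section CubeMatrix

variable {ι : Type*} [Fintype ι] [LinearOrder ι] {k : ℕ} {V : EvenVertex ι → Fin k}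

/-- The rows `(x, 1)` and `(x, -1)` of the model design belong to the odd vertex `x` of the cube,
and its indeterminates to the even vertices. Row `(x, b)` contains the indeterminates of the
neighbours of `x`, conjugated if `b = -1`; the neighbour in direction `i` is in one of the two
columns `(i, 1)` and `(i, -1)`, the other entry being `0`. -/
def cubeMatrix (V : EvenVertex ι → Fin k) : Matrix (OddVertex ι × ℤˣ) (ι × ℤˣ) (Entry k) :=
  .of fun q c => if c.2 = q.2 * q.1.1 c.1 then
    .var (q.1.1.koszulSign c.1) (decide (q.2 = -1)) (V (q.1.flip c.1)) else 0

theorem cubeMatrix_ne_zero_iff {q : OddVertex ι × ℤˣ} {c : ι × ℤˣ} :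
    cubeMatrix V q c ≠ 0 ↔ c.2 = q.2 * q.1.1 c.1 := by
  simp [cubeMatrix]

theorem cubeMatrix_flip (y : EvenVertex ι) (b : ℤˣ) (i : ι) :
    cubeMatrix V (y.flip i, b) (i, -b * y.1 i) =
      .var (y.1.koszulSign i) (decide (b = -1)) (V y) := by
  simp [cubeMatrix]

theorem cubeMatrix_neg_neg (x : OddVertex ι) (b a : ℤˣ) (i : ι) :
    cubeMatrix V (x, -b) (i, -a) = star (cubeMatrix V (x, b) (i, a)) := by
  obtain rfl | h := eq_or_ne a (b * x.1 i)
  · rcases Int.units_eq_one_or b with rfl | rfl <;> simp [cubeMatrix]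
  · simp [cubeMatrix, h]

theorem cubeMatrix_map_rename {l : ℕ} (f : Fin k → Fin l) :
    (cubeMatrix V).map (Entry.rename f) = cubeMatrix (f ∘ V) := by
  ext q c
  simp only [cubeMatrix, Matrix.map_apply, Matrix.of_apply, apply_ite (Entry.rename f),
    Entry.rename_var, Entry.rename_zero, Function.comp_apply]

theorem card_cubeMatrix_ne_zero (q : OddVertex ι × ℤˣ) :
    (Finset.univ.filter fun c => cubeMatrix V q c ≠ 0).card = Fintype.card ι := by
  rw [Finset.card_filter, Fintype.sum_prod_type]
  simp only [cubeMatrix_ne_zero_iff, Finset.sum_ite_eq', Finset.mem_univ, if_true,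
    Finset.sum_const, Finset.card_univ, smul_eq_mul, mul_one]

theorem card_cubeMatrix_eq_zero (q : OddVertex ι × ℤˣ) :
    (Finset.univ.filter fun c => cubeMatrix V q c = 0).card = Fintype.card ι := by
  have hsum := Finset.card_filter_add_card_filter_not (s := Finset.univ)
    fun c => cubeMatrix V q c = 0
  rw [card_cubeMatrix_ne_zero, Finset.card_univ, Fintype.card_prod, Fintype.card_units_int] at hsum
  lia

section Orthogonality

variable (v : Fin k → ℂ)

theorem sum_star_mul_cubeMatrix_self (V : EvenVertex ι ≃ Fin k) (c : ι × ℤˣ) :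
    ∑ q, star ((cubeMatrix V q c).eval v) * (cubeMatrix V q c).eval v =
      ((∑ j, ‖v j‖ ^ 2 : ℝ) : ℂ) := by
  obtain ⟨i, a⟩ := c
  have hentry (x : OddVertex ι) (b : ℤˣ) :
      star ((cubeMatrix V (x, b) (i, a)).eval v) * (cubeMatrix V (x, b) (i, a)).eval v =
        if b = a * x.1 i then ((‖v (V (x.flip i))‖ ^ 2 : ℝ) : ℂ) else 0 := by
    have hcond : a = b * x.1 i ↔ b = a * x.1 i := by
      constructor <;> rintro rfl <;> simp [mul_assoc, Int.units_mul_self]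
    by_cases h : b = a * x.1 i
    · rw [if_pos h, ← Entry.star_eval_mul_eval_var, cubeMatrix, Matrix.of_apply,
        if_pos (hcond.mpr h)]
    · simp [cubeMatrix, hcond, h]
  rw [Fintype.sum_prod_type]
  simp only [hentry, Finset.sum_ite_eq', Finset.mem_univ, if_true, Complex.ofReal_sum]
  exact Fintype.sum_equiv ((EvenVertex.flipEquiv i).symm.trans V) _ _ fun _ => rfl

theorem cubeMatrix_flip_flip {x : OddVertex ι} {b a a' : ℤˣ} {i s : ι} (his : i ≠ s)
    (ha : a = b * x.1 i) (ha' : a' = b * x.1 s) :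
    cubeMatrix V ((x.flip i).flip s, -b) (i, a) =
      (x.1.koszulSign s * (x.1.flip s).koszulSign i) • star (cubeMatrix V (x, b) (s, a')) := by
  have hflip : (x.flip i).flip s = (x.flip s).flip i := Subtype.ext (Cube.flip_comm ..)
  have ha : a = -(-b) * (x.flip s).1 i := by
    rw [neg_neg, ha, OddVertex.coe_flip, Cube.flip_of_ne _ his]
  rw [hflip, ha, cubeMatrix_flip, ha', cubeMatrix, Matrix.of_apply, if_pos rfl, Entry.star_var,
    Entry.smul_var, mul_right_comm, Int.units_mul_self, one_mul]
  rcases Int.units_eq_one_or b with rfl | rfl <;> rfl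

theorem sum_star_mul_cubeMatrix_of_ne (V : EvenVertex ι → Fin k) {c d : ι × ℤˣ} (hcd : c ≠ d) :
    ∑ q, star ((cubeMatrix V q c).eval v) * (cubeMatrix V q d).eval v = 0 := by
  obtain ⟨⟨i, a⟩, s, a'⟩ := c, d
  have hzero (x : OddVertex ι) (b : ℤˣ) (h : ¬(a = b * x.1 i ∧ a' = b * x.1 s)) :
      star ((cubeMatrix V (x, b) (i, a)).eval v) * (cubeMatrix V (x, b) (s, a')).eval v = 0 := by
    rw [not_and_or] at h
    rcases h with h | h <;> simp [cubeMatrix, h]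
  obtain rfl | his := eq_or_ne i s
  · refine Finset.sum_eq_zero fun q _ => hzero _ _ fun h => hcd ?_
    rw [h.1, h.2]
  · refine Finset.sum_involution (fun q _ => ((q.1.flip i).flip s, -q.2)) ?_ ?_ ?_ ?_
    · rintro ⟨x, b⟩ -
      have hflip : (x.flip i).flip s = (x.flip s).flip i := Subtype.ext (Cube.flip_comm ..)
      by_cases h : a = b * x.1 i ∧ a' = b * x.1 s
      · rw [cubeMatrix_flip_flip his h.1 h.2, hflip, cubeMatrix_flip_flip his.symm h.2 h.1,
          x.1.koszulSign_square his]
        simp only [Entry.eval_smul, Entry.eval_star, star_mul, star_star]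
        rcases Int.units_eq_one_or (x.1.koszulSign s * (x.1.flip s).koszulSign i) with h | h <;>
          simp [h, mul_comm]
      · rw [hzero _ _ h, hzero, zero_add]
        simpa [his, his.symm] using h
    · rintro ⟨x, b⟩ - - h
      exact units_ne_neg_self b (congrArg Prod.snd h).symm
    · simp
    · rintro ⟨x, b⟩ -
      refine Prod.ext (Subtype.ext ?_) (neg_neg b)
      simp [Cube.flip_comm _ i s]

end Orthogonality

end CubeMatrix

section CubeDesign

variable {p m k : ℕ} {G H : Design p (2 * m) k}

/-- With rows, columns and indeterminates labelled by `A`, `C` and `V`, the design `G` becomes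
`cubeMatrix` up to signs of its rows and indeterminates. -/
def IsCubeLabelling (G : Design p (2 * m) k) (A : OddVertex (Fin m) × ℤˣ → Fin p)
    (C : Fin m × ℤˣ → Fin (2 * m)) (V : EvenVertex (Fin m) → Fin k) : Prop :=
  ∃ (ρ : OddVertex (Fin m) × ℤˣ → ℤˣ) (η : Fin k → ℤˣ),
    ∀ q c, G (A q) (C c) = ρ q • (cubeMatrix V q c).twist η fun _ => false

/-- `G` has rows, columns and indeterminates bijectively labelled as in `cubeMatrix`. -/
def IsCubeDesign (G : Design p (2 * m) k) : Prop :=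
  ∃ (A : OddVertex (Fin m) × ℤˣ ≃ Fin p) (C : Fin m × ℤˣ ≃ Fin (2 * m))
    (V : EvenVertex (Fin m) ≃ Fin k), IsCubeLabelling G A C V

theorem card_oddVertex_prod_units [NeZero m] :
    Fintype.card (OddVertex (Fin m) × ℤˣ) = 2 ^ m := by
  rw [Fintype.card_prod, card_oddVertex, Fintype.card_units_int, Fintype.card_fin,
    pow_sub_one_mul (NeZero.ne m)]

theorem IsCubeDesign.card_rows [NeZero m] (hG : IsCubeDesign G) : p = 2 ^ m := by
  obtain ⟨A, -⟩ := hG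
  rw [← Fintype.card_fin p, ← Fintype.card_congr A, card_oddVertex_prod_units]

theorem IsCubeDesign.card_indets [NeZero m] (hG : IsCubeDesign G) : k = 2 ^ (m - 1) := by
  obtain ⟨-, -, V, -⟩ := hG
  rw [← Fintype.card_fin k, ← Fintype.card_congr V, card_evenVertex, Fintype.card_fin]

theorem IsCubeDesign.exists_rename (hG : IsCubeDesign G) (V : EvenVertex (Fin m) ≃ Fin k) :
    ∃ (τ : Equiv.Perm (Fin k)) (A : OddVertex (Fin m) × ℤˣ ≃ Fin p)
      (C : Fin m × ℤˣ ≃ Fin (2 * m)), IsCubeLabelling ((Op.instRename τ).apply G) A C V := by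
  obtain ⟨A, C, V', ρ, η, h⟩ := hG
  refine ⟨V'.symm.trans V, A, C, ρ, η ∘ V.symm.trans V', fun q c => ?_⟩
  have hV : cubeMatrix V = (cubeMatrix V').map (Entry.rename (V'.symm.trans V)) := by
    rw [cubeMatrix_map_rename]
    congr 1
    ext y
    simp
  rw [hV, Op.apply, Matrix.map_apply, Matrix.map_apply, h]
  induction cubeMatrix V' q c <;> simp

theorem IsCubeDesign.equivalentWithoutColNeg (hG : IsCubeDesign G) (hH : IsCubeDesign H) :
    EquivalentWithoutColNeg G H := by
  obtain ⟨A', C', V, ρ', η', hH⟩ := hH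
  obtain ⟨τ, A, C, ρ, η, hG⟩ := hG.exists_rename V
  have hrename : EquivalentWithoutColNeg G ((Op.instRename τ).apply G) :=
    (TransformsTo.refl G).apply nofun
  refine hrename.trans (Similar.equivalentWithoutColNeg ⟨A'.symm.trans A, C'.symm.trans C,
    fun r => ρ' (A'.symm r) * ρ (A'.symm r), η' * η, fun _ => false, fun r c => ?_⟩)
  obtain ⟨q, rfl⟩ := A'.surjective r
  obtain ⟨c, rfl⟩ := C'.surjective c
  simp only [Equiv.trans_apply, Equiv.symm_apply_apply, hG, hH, Entry.twist_smul, mul_smul,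
    Entry.smul_smul_self]
  induction cubeMatrix V q c <;> simp [mul_assoc, ← mul_assoc (η _), Int.units_mul_self]

theorem Connected.exists_isCubeLabelling (hconn : Connected G) (hG : IsBCOD G) (i₀ : Fin m) :
    ∃ (A : OddVertex (Fin m) × ℤˣ → Fin p) (C : Fin m × ℤˣ ≃ Fin (2 * m))
      (V : EvenVertex (Fin m) ≃ Fin k), IsCubeLabelling G A C V := by
  obtain ⟨B⟩ := Classical.nonempty_pi.mpr hG.nonempty_blockForm
  let j₀ : Fin k := ⟨0, hG.isCOD.1⟩
  obtain ⟨Φ, A, ρ, η, h⟩ := BlockForm.exists_component_coordinates B j₀ i₀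
  let V : EvenVertex (Fin m) ≃ Fin k := Φ.trans (Equiv.subtypeUnivEquiv fun l => hconn j₀ l)
  refine ⟨A, (B j₀).chart, V, ρ, η ∘ V.symm, ?_⟩
  rintro ⟨x, b⟩ ⟨i, a⟩
  obtain ⟨y, rfl⟩ := (EvenVertex.flipEquiv i).surjective x
  obtain ⟨hvertex, hrow⟩ := h y
  obtain ⟨hrow, hsign⟩ := hrow i b
  have hpairs := BlockForm.pairsBy_component B (Φ y)
  rw [EvenVertex.flipEquiv_apply, ← hrow]
  by_cases ha : a = -b * y.1 i
  · have hcol : (B j₀).chart (i, a) = (B (Φ y)).column (B j₀).chart i b := by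
      rw [BlockForm.column, hvertex, ha]
    rw [hcol, (B (Φ y)).apply_row_self, hpairs.conj_column, hsign, ha, cubeMatrix_flip]
    simp [V]
  · have hG : G _ ((B j₀).chart (i, a)) = 0 :=
      not_not.mp (mt (hpairs.ne_zero_iff i b i a).mp (by simpa [hvertex] using ha))
    have hcube : cubeMatrix V (y.flip i, b) (i, a) = 0 :=
      not_not.mp (mt cubeMatrix_ne_zero_iff.mp (by simpa using ha))
    rw [hG, hcube, Entry.twist_zero, Entry.smul_zero]

section IsCubeLabelling

variable {A : OddVertex (Fin m) × ℤˣ → Fin p} {C : Fin m × ℤˣ ≃ Fin (2 * m)}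
  {V : EvenVertex (Fin m) ≃ Fin k} (h : IsCubeLabelling G A C V)

include h

theorem IsCubeLabelling.ne_zero_iff {q : OddVertex (Fin m) × ℤˣ} {c : Fin m × ℤˣ} :
    G (A q) (C c) ≠ 0 ↔ c.2 = q.2 * q.1.1 c.1 := by
  obtain ⟨ρ, η, h⟩ := h
  rw [← cubeMatrix_ne_zero_iff (V := V), h]
  induction cubeMatrix V q c <;> simp

theorem IsCubeLabelling.exists_apply_eq_var (x : OddVertex (Fin m)) (b : ℤˣ) (i : Fin m) :
    ∃ s, G (A (x, b)) (C (i, b * x.1 i)) = .var s (decide (b = -1)) (V (x.flip i)) := by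
  obtain ⟨ρ, η, h⟩ := h
  rw [h, cubeMatrix, Matrix.of_apply, if_pos rfl]
  exact ⟨_, by simp only [Entry.twist_var, Entry.smul_var, Bool.xor_false]; rfl⟩

theorem IsCubeLabelling.injective [NeZero m] : A.Injective := by
  rintro ⟨x, b⟩ ⟨x', b'⟩ hA
  obtain ⟨s, hs⟩ := h.exists_apply_eq_var x b 0
  obtain ⟨s', hs'⟩ := h.exists_apply_eq_var x' b' 0
  rw [hA] at hs
  have hcol : b * x.1 0 = b' * x'.1 0 := h.ne_zero_iff.mp (hs ▸ Entry.var_ne_zero _ _ _)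
  rw [hcol, hs'] at hs
  obtain ⟨-, hb, hx⟩ := Entry.var.inj hs
  have hx : x' = x := by rw [← x.flip_flip 0, ← V.injective hx, OddVertex.flip_flip]
  rw [hx] at hcol ⊢
  rw [mul_right_cancel hcol]

theorem IsCubeLabelling.surjective [NeZero m] (hG : IsBCOD G) : A.Surjective := by
  intro r
  obtain ⟨c, hc⟩ : (Finset.univ.filter fun c => G r c ≠ 0).Nonempty := by
    rw [← Finset.card_pos, hG.card_nonzero]
    exact NeZero.pos m
  obtain ⟨s, b, j, hj⟩ := Entry.exists_eq_var (Finset.mem_filter.mp hc).2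
  obtain ⟨⟨i, a⟩, rfl⟩ := C.surjective c
  obtain ⟨y, rfl⟩ := V.surjective j
  obtain ⟨s', hs'⟩ := h.exists_apply_eq_var (y.flip i) (-a * y.1 i) i
  have ha : -a * y.1 i * (y.flip i).1 i = a := by simp [mul_assoc, Int.units_mul_self]
  rw [ha, EvenVertex.flip_flip] at hs'
  exact ⟨_, (hG.isCOD.existsUnique_row _ _).unique ⟨_, _, hs'⟩ ⟨_, _, hj⟩⟩

end IsCubeLabelling

theorem Connected.isCubeDesign [NeZero m] (hconn : Connected G) (hG : IsBCOD G) :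
    IsCubeDesign G :=
  let ⟨A, C, V, h⟩ := hconn.exists_isCubeLabelling hG 0
  ⟨.ofBijective A ⟨h.injective, h.surjective hG⟩, C, V, h⟩

theorem IsBCOD.connected [NeZero m] {G : Design p (2 * m) (2 ^ (m - 1))} (hG : IsBCOD G) :
    Connected G := by
  obtain ⟨B⟩ := Classical.nonempty_pi.mpr hG.nonempty_blockForm
  intro j₀ l
  obtain ⟨Φ, -⟩ := BlockForm.exists_component_coordinates B j₀ 0
  have hcard : Nat.card (Fin (2 ^ (m - 1))) ≤ Nat.card (BlockForm.Component G j₀) := by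
    rw [← Nat.card_congr Φ, Nat.card_eq_fintype_card (α := EvenVertex _), card_evenVertex,
      Fintype.card_fin, Nat.card_fin]
  obtain ⟨⟨l, hl⟩, rfl⟩ := (Subtype.val_injective.bijective_of_nat_card_le hcard).surjective l
  exact hl

end CubeDesign

section StandardDesign

variable {p m k : ℕ} (A : OddVertex (Fin m) × ℤˣ ≃ Fin p) (C : Fin m × ℤˣ ≃ Fin (2 * m))
  (V : EvenVertex (Fin m) ≃ Fin k)

/-- The model design, with numbered rows, columns and indeterminates. -/
def standardDesign : Design p (2 * m) k := (cubeMatrix V).submatrix A.symm C.symm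

theorem isCOD_standardDesign : IsCOD (standardDesign A C V) := by
  refine ⟨(V ⟨1, by simp⟩).pos, fun v => ?_⟩
  ext c d
  obtain ⟨c, rfl⟩ := C.surjective c
  obtain ⟨d, rfl⟩ := C.surjective d
  simp only [Matrix.mul_apply, Matrix.conjTranspose_apply, Matrix.map_apply, standardDesign,
    Matrix.submatrix_apply, Equiv.symm_apply_apply, Matrix.smul_apply, smul_eq_mul,
    Equiv.sum_comp A.symm fun q =>
      star ((cubeMatrix V q c).eval v) * (cubeMatrix V q d).eval v]
  obtain rfl | hcd := eq_or_ne c d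
  · rw [sum_star_mul_cubeMatrix_self, Matrix.one_apply_eq, mul_one]
  · rw [sum_star_mul_cubeMatrix_of_ne _ _ hcd, Matrix.one_apply_ne (C.injective.ne hcd), mul_zero]

theorem conjugationSeparated_standardDesign : ConjugationSeparated (standardDesign A C V) := by
  refine fun r => ⟨decide ((A.symm r).2 = -1), fun c s b' i h => ?_⟩
  rw [standardDesign, Matrix.submatrix_apply, cubeMatrix, Matrix.of_apply] at h
  split at h
  · exact (Entry.var.inj h).2.1.symm
  · exact absurd h (Entry.zero_ne_var _ _ _)

/-- The skew-symmetric matrix `M_j` of the model design, for the indeterminate of the vertex `y`. -/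
def cubeSkewMatrix (V : EvenVertex (Fin m) → Fin k) (y : EvenVertex (Fin m)) :
    Matrix (Fin m) (Fin m) (Entry k) :=
  .of fun i l => y.1.koszulSign i • cubeMatrix V (y.flip i, 1) (l, y.1 l)

theorem cubeSkewMatrix_transpose (V : EvenVertex (Fin m) → Fin k) (y : EvenVertex (Fin m)) :
    (cubeSkewMatrix V y).transpose = -cubeSkewMatrix V y := by
  ext i l
  obtain rfl | hil := eq_or_ne i l
  · simp [cubeSkewMatrix, cubeMatrix, units_ne_neg_self]
  · have hflip : (y.flip l).flip i = (y.flip i).flip l := Subtype.ext (Cube.flip_comm ..)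
    simp [cubeSkewMatrix, cubeMatrix, hil, hil.symm, hflip, y.1.koszulSign_square hil]

/-- The rows of the model design which contain the indeterminate of the vertex `y`. -/
def cubeBlockRow (y : EvenVertex (Fin m)) : Fin m ⊕ Fin m → OddVertex (Fin m) × ℤˣ :=
  Sum.elim (fun i => (y.flip i, 1)) (fun i => (y.flip i, -1))

theorem cubeBlockRow_injective (y : EvenVertex (Fin m)) : (cubeBlockRow y).Injective := by
  have hflip {i l : Fin m} (h : y.flip i = y.flip l) : i = l := by
    by_contra hil
    have hi := congrFun (congrArg Subtype.val h) i
    simp [hil, units_ne_neg_self, eq_comm] at hi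
  refine Function.Injective.sumElim (fun i l h => hflip (congrArg Prod.fst h))
    (fun i l h => hflip (congrArg Prod.fst h)) fun i l h => ?_
  exact units_ne_neg_self 1 (congrArg Prod.snd h)

theorem smul_cubeMatrix_eq_skewBlock (y : EvenVertex (Fin m)) (a c : Fin m ⊕ Fin m) :
    y.1.koszulSign (a.elim id id) • cubeMatrix V (cubeBlockRow y a) (vertexHalves y c) =
      skewBlock false (V y) (cubeSkewMatrix V y) a c := by
  have hleft (i : Fin m) (c : Fin m ⊕ Fin m) :
      y.1.koszulSign i • cubeMatrix V (y.flip i, 1) (vertexHalves y c) =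
        skewBlock false (V y) (cubeSkewMatrix V y) (.inl i) c := by
    rcases c with l | l
    · obtain rfl | hil := eq_or_ne i l
      · simp [vertexHalves, cubeMatrix, skewBlock, Int.units_mul_self]
      · simp [vertexHalves, cubeMatrix, skewBlock, hil, hil.symm, (units_ne_neg_self _).symm]
    · rfl
  rcases a with i | i
  · exact hleft i c
  · obtain ⟨c, rfl⟩ := Sum.swap_rightInverse.surjective c
    have hswap := skewBlock_swap_swap (b := false) (j := V y) (cubeSkewMatrix_transpose V y)
      (.inl i) c
    rw [Sum.swap_inl] at hswap
    rw [hswap, ← hleft, Entry.star_smul, ← cubeMatrix_neg_neg, vertexHalves_swap]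
    rfl

theorem containsSkewB_standardDesign (j : Fin k) :
    ∃ G' : Design p (2 * m) k,
      TransformsTo (fun o => o.NotColNeg ∧ o.NotRename) (standardDesign A C V) G' ∧
        ContainsSkewB j G' := by
  obtain ⟨y, rfl⟩ := V.surjective j
  let f : Fin m ⊕ Fin m ↪ Fin p :=
    ⟨A ∘ cubeBlockRow y, A.injective.comp (cubeBlockRow_injective y)⟩
  let κ : Equiv.Perm (Fin (2 * m)) := (halves m).symm.trans ((vertexHalves y.1).trans C)
  let ρ : Fin p → ℤˣ := Function.extend f (fun a => y.1.koszulSign (a.elim id id)) 1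
  let G' : Design p (2 * m) k := .of fun r c => ρ r • standardDesign A C V r (κ c)
  refine ⟨G', transformsTo_iff_similar.mpr ⟨1, κ, ρ, 1, fun _ => false, by simp [G']⟩, f,
    cubeSkewMatrix V y, cubeSkewMatrix_transpose V y, ?_⟩
  ext a c
  refine Eq.trans ?_ (smul_cubeMatrix_eq_skewBlock V y a c)
  have hρ : ρ (A (cubeBlockRow y a)) = y.1.koszulSign (a.elim id id) :=
    f.injective.extend_apply _ _ a
  simp [G', hρ, κ, f, standardDesign]

theorem card_standardDesign (P : Entry k → Prop) [DecidablePred P] (r : Fin p) :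
    (Finset.univ.filter fun c => P (standardDesign A C V r c)).card =
      (Finset.univ.filter fun c => P (cubeMatrix V (A.symm r) c)).card :=
  Finset.card_equiv C.symm fun _ => by rw [Finset.mem_filter_univ, Finset.mem_filter_univ]; rfl

theorem isBCOD_standardDesign : IsBCOD (standardDesign A C V) where
  isCOD := isCOD_standardDesign A C V
  card_zero r := by
    rw [card_standardDesign A C V (· = 0), card_cubeMatrix_eq_zero, Fintype.card_fin]
  card_nonzero r := by
    rw [card_standardDesign A C V (· ≠ 0), card_cubeMatrix_ne_zero, Fintype.card_fin]
  conjSep := conjugationSeparated_standardDesign A C V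
  skew := containsSkewB_standardDesign A C V

theorem exists_isBCOD (m : ℕ) [NeZero m] :
    ∃ G : Design (2 ^ m) (2 * m) (2 ^ (m - 1)), IsBCOD G :=
  ⟨_, isBCOD_standardDesign (Fintype.equivFinOfCardEq card_oddVertex_prod_units)
    (Fintype.equivFinOfCardEq (by simp [mul_comm]))
    (Fintype.equivFinOfCardEq (card_evenVertex.trans (by rw [Fintype.card_fin])))⟩

end StandardDesign

section Rename

variable {p n k l q : ℕ}

theorem Entry.rename_rename (f : Fin k → Fin l) (g : Fin l → Fin q) (e : Entry k) :
    rename g (rename f e) = rename (g ∘ f) e := by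
  induction e <;> simp

theorem Entry.eval_rename (f : Fin k → Fin l) (v : Fin l → ℂ) (e : Entry k) :
    eval v (rename f e) = eval (v ∘ f) e := by
  induction e <;> rfl

theorem Entry.rename_eq_var_iff {f : Fin k → Fin l} {e : Entry k} {s : ℤˣ} {b : Bool} {j : Fin l} :
    rename f e = var s b j ↔ ∃ i, f i = j ∧ e = var s b i := by
  induction e with
  | zero => simp
  | var s' b' i => simpa using by grind

theorem exists_map_rename_eq {f : Fin k → Fin l} {H : Design p n l}
    (h : ∀ r j, OccursIn H j r → j ∈ Set.range f) :
    ∃ G : Design p n k, G.map (Entry.rename f) = H := by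
  have hentry (r : Fin p) (c : Fin n) : ∃ x, Entry.rename f x = H r c := by
    induction hx : H r c with
    | zero => exact ⟨0, rfl⟩
    | var s b j =>
      obtain ⟨i, rfl⟩ := h r j ⟨c, s, b, hx⟩
      exact ⟨.var s b i, rfl⟩
  choose G hG using hentry
  exact ⟨G, Matrix.ext hG⟩

theorem occursIn_relabel {G : Design p n k} {e : Fin q → Fin p} {t : Fin k ≃ Fin l} {j : Fin l}
    {r : Fin q} :
    OccursIn ((G.submatrix e id).map (Entry.rename t)) j r ↔ OccursIn G (t.symm j) (e r) := by
  refine exists_congr fun c => exists₂_congr fun s b => ?_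
  rw [Matrix.map_apply, Matrix.submatrix_apply, id]
  induction G (e r) c <;> simp [Equiv.eq_symm_apply]

end Rename

section Decomposition

variable {p n k p₁ k₁ p₂ k₂ : ℕ} {G : Design p n k} {G₁ : Design p₁ n k₁} {G₂ : Design p₂ n k₂}

theorem IsCOD.of_map_rename (hG : IsCOD G) (hk : 0 < k₁) {f : Fin k₁ → Fin k} (hf : f.Injective)
    {ε : Fin p₁ → Fin p} (hε : ε.Injective) (hrename : G₁.map (Entry.rename f) = G.submatrix ε id)
    (hoccurs : ∀ i r, OccursIn G (f i) r → r ∈ Set.range ε) : IsCOD G₁ := by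
  refine ⟨hk, fun v => ?_⟩
  have hsum : ∑ i, ‖v i‖ ^ 2 = ∑ j, ‖Function.extend f v 0 j‖ ^ 2 :=
    Fintype.sum_of_injective f hf _ _ (fun j hj => by simp [Function.extend_apply' _ _ _ hj])
      fun i => by rw [hf.extend_apply]
  have heval (r : Fin p₁) (c : Fin n) :
      (G (ε r) c).eval (Function.extend f v 0) = (G₁ r c).eval v := by
    have hentry : G (ε r) c = (G₁ r c).rename f := (congrFun₂ hrename r c).symm
    rw [hentry, Entry.eval_rename, Function.extend_comp hf]
  have hzero (r : Fin p) (hr : r ∉ Set.range ε) (c : Fin n) :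
      (G r c).eval (Function.extend f v 0) = 0 := by
    induction hx : G r c with
    | zero => rfl
    | var s b j =>
      have hj : ¬∃ i, f i = j := fun ⟨i, hi⟩ => hr (hoccurs i r ⟨c, s, b, hi ▸ hx⟩)
      simp [Entry.eval, Function.extend_apply' _ _ _ hj]
  rw [hsum, ← hG.2]
  ext c d
  simp only [Matrix.mul_apply, Matrix.conjTranspose_apply, Matrix.map_apply]
  exact Fintype.sum_of_injective ε hε _ _ (fun r hr => by rw [hzero r hr d, mul_zero])
    fun r => by rw [heval, heval]

theorem exists_equiv_range_castAdd_eq (s : Set (Fin n)) :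
    ∃ (n₁ n₂ : ℕ) (e : Fin (n₁ + n₂) ≃ Fin n),
      Set.range (e ∘ Fin.castAdd n₂) = s ∧ Set.range (e ∘ Fin.natAdd n₁) = sᶜ := by
  classical
  let e₁ := (Fintype.equivFin s).symm
  let e₂ := (Fintype.equivFin ↑sᶜ).symm
  refine ⟨_, _, (finSumFinEquiv.symm.trans (e₁.sumCongr e₂)).trans (Equiv.Set.sumCompl s), ?_, ?_⟩
  · refine Eq.trans ?_ ((EquivLike.range_comp Subtype.val e₁).trans Subtype.range_coe)
    congr 1
    ext
    simp
  · refine Eq.trans ?_ ((EquivLike.range_comp Subtype.val e₂).trans Subtype.range_coe)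
    congr 1
    ext
    simp

theorem directSum_castAdd (r : Fin p₁) (c : Fin n) :
    directSum G₁ G₂ (Fin.castAdd p₂ r) c = (G₁ r c).rename (Fin.castAdd k₂) := by
  simp [directSum]

theorem directSum_natAdd (r : Fin p₂) (c : Fin n) :
    directSum G₁ G₂ (Fin.natAdd p₁ r) c = (G₂ r c).rename (Fin.natAdd k₁) := by
  simp [directSum]

theorem IsCOD.decomposable (hG : IsCOD G) {K : Set (Fin k)}
    (hK : ∀ j l, Shares G j l → j ∈ K → l ∈ K) (hne : K.Nonempty) (hne' : Kᶜ.Nonempty) :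
    Decomposable G := by
  let R : Set (Fin p) := {r | ∃ j ∈ K, OccursIn G j r}
  have hKR {j r} (hj : OccursIn G j r) : j ∈ K ↔ r ∈ R :=
    ⟨fun h => ⟨j, h, hj⟩, fun ⟨l, hl, hlr⟩ => hK l j ⟨r, hlr, hj⟩ hl⟩
  obtain ⟨k₁, k₂, t, ht₁, ht₂⟩ := exists_equiv_range_castAdd_eq K
  obtain ⟨p₁, p₂, e, he₁, he₂⟩ := exists_equiv_range_castAdd_eq R
  obtain ⟨G₁, hG₁⟩ : ∃ G₁ : Design p₁ n k₁,
      G₁.map (Entry.rename (t ∘ Fin.castAdd k₂)) = G.submatrix (e ∘ Fin.castAdd p₂) id :=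
    exists_map_rename_eq fun r j hj => ht₁.ge ((hKR hj).mpr (he₁.le (Set.mem_range_self r)))
  obtain ⟨G₂, hG₂⟩ : ∃ G₂ : Design p₂ n k₂,
      G₂.map (Entry.rename (t ∘ Fin.natAdd k₁)) = G.submatrix (e ∘ Fin.natAdd p₁) id :=
    exists_map_rename_eq fun r j hj =>
      ht₂.ge ((hKR hj).not.mpr (he₂.le (Set.mem_range_self r)))
  have hcod₁ : IsCOD G₁ := by
    obtain ⟨i, -⟩ := ht₁.ge hne.some_mem
    exact hG.of_map_rename i.pos (t.injective.comp (Fin.castAdd_injective _ _))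
      (e.injective.comp (Fin.castAdd_injective _ _)) hG₁ fun i r hi =>
        he₁.ge ((hKR hi).mp (ht₁.le (Set.mem_range_self i)))
  have hcod₂ : IsCOD G₂ := by
    obtain ⟨i, -⟩ := ht₂.ge hne'.some_mem
    exact hG.of_map_rename i.pos (t.injective.comp (Fin.natAdd_injective _ _))
      (e.injective.comp (Fin.natAdd_injective _ _)) hG₂ fun i r hi =>
        he₂.ge ((hKR hi).not.mp (ht₂.le (Set.mem_range_self i)))
  refine ⟨p₁, p₂, k₁, k₂, G₁, G₂, e.symm, t, hcod₁, hcod₂, ?_⟩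
  ext r c
  obtain ⟨r, rfl⟩ := e.surjective r
  rw [Matrix.map_apply, Matrix.submatrix_apply, Equiv.symm_apply_apply, id]
  induction r using Fin.addCases with
  | left r => rw [directSum_castAdd, Entry.rename_rename]; exact (congrFun₂ hG₁ r c).symm
  | right r => rw [directSum_natAdd, Entry.rename_rename]; exact (congrFun₂ hG₂ r c).symm

theorem IsCOD.connected (hG : IsCOD G) (h : Indecomposable G) : Connected G := by
  intro j
  by_contra! hj
  exact h (hG.decomposable (K := {l | Relation.ReflTransGen (Shares G) j l})
    (fun _ _ hshares hl => hl.tail hshares) ⟨j, .refl⟩ hj)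

theorem OccursIn.lt_iff_lt {j : Fin (k₁ + k₂)} {r : Fin (p₁ + p₂)}
    (h : OccursIn (directSum G₁ G₂) j r) : (j : ℕ) < k₁ ↔ (r : ℕ) < p₁ := by
  obtain ⟨c, s, b, h⟩ := h
  induction r using Fin.addCases with
  | left r =>
    obtain ⟨i, rfl, -⟩ := Entry.rename_eq_var_iff.mp ((directSum_castAdd r c).symm.trans h)
    simp
  | right r =>
    obtain ⟨i, rfl, -⟩ := Entry.rename_eq_var_iff.mp ((directSum_natAdd r c).symm.trans h)
    simp

theorem Connected.indecomposable (hG : Connected G) : Indecomposable G := by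
  rintro ⟨p₁, p₂, k₁, k₂, G₁, G₂, e, t, hG₁, hG₂, rfl⟩
  have hside (j l : Fin k) : (t.symm j : ℕ) < k₁ ↔ (t.symm l : ℕ) < k₁ := by
    induction hG j l with
    | refl => rfl
    | tail _ hshares ih =>
      obtain ⟨r, hj, hl⟩ := hshares
      exact ih.trans ((occursIn_relabel.mp hj).lt_iff_lt.trans
        (occursIn_relabel.mp hl).lt_iff_lt.symm)
  have h := hside (t (Fin.castAdd k₂ ⟨0, hG₁.1⟩)) (t (Fin.natAdd k₁ ⟨0, hG₂.1⟩))
  simp [hG₁.1] at h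

end Decomposition

theorem Design.cast_self {p n k : ℕ} (G : Design p n k) : G.cast rfl rfl = G := by
  ext r c
  simp only [Design.cast, Matrix.map_apply, Matrix.submatrix_apply, Fin.cast_refl, id]
  induction G r c <;> rfl

end COD

theorem mainTheorem2 (m : ℕ) (hm : 1 ≤ m) :
    (∀ G H : COD.Design (2 ^ m) (2 * m) (2 ^ (m - 1)), COD.IsBCOD G → COD.IsBCOD H →
      COD.Equivalent G H ∧ COD.EquivalentWithoutColNeg G H) ∧
    (∃ G₀ : COD.Design (2 ^ m) (2 * m) (2 ^ (m - 1)),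
      COD.IsBCOD G₀ ∧ COD.Indecomposable G₀ ∧
      ∀ (p k : ℕ) (G : COD.Design p (2 * m) k), COD.IsBCOD G → COD.Indecomposable G →
        ∃ (hp : p = 2 ^ m) (hk : k = 2 ^ (m - 1)),
          COD.Equivalent (G.cast hp hk) G₀ ∧
            COD.EquivalentWithoutColNeg (G.cast hp hk) G₀) := by
  have : NeZero m := ⟨Nat.one_le_iff_ne_zero.mp hm⟩
  have isCubeDesign (G : COD.Design (2 ^ m) (2 * m) (2 ^ (m - 1))) (hG : COD.IsBCOD G) :
      COD.IsCubeDesign G := hG.connected.isCubeDesign hG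
  refine ⟨fun G H hG hH => ?_, ?_⟩
  · have h := (isCubeDesign G hG).equivalentWithoutColNeg (isCubeDesign H hH)
    exact ⟨h.equivalent, h⟩
  · obtain ⟨G₀, hG₀⟩ := COD.exists_isBCOD m
    refine ⟨G₀, hG₀, hG₀.connected.indecomposable, fun p k G hG hindec => ?_⟩
    have hcube := (hG.isCOD.connected hindec).isCubeDesign hG
    obtain rfl := hcube.card_rows
    obtain rfl := hcube.card_indets
    have h := hcube.equivalentWithoutColNeg (isCubeDesign G₀ hG₀)
    rw [← G.cast_self] at h
    exact ⟨rfl, rfl, h.equivalent, h⟩
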